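/- Let $m$ be Lebesgue measure on $[0,1]$; functions are real-valued, measurable, and identified when equal a.e. A Banach function space $X$ on $[0,1]$ is a linear space of measurable functions with a complete norm such that $g\in X$ and $|f|\le |g|$ a.e. imply $f\in X$ and $\|f\|_X\le\|g\|_X$. It is rearrangement invariant (r.i.) if $f\in X$ and $m(\{|f|>s\})=m(\{|g|>s\})$ for all $s>0$ imply $g\in X$ and $\|g\|_X=\|f\|_X$. Let $M_2(t)=e^{t^2}-1$, let $L^{M_2}$ be the Orlicz space of all $f$ for which $\|f\|_{L^{M_2}}=\inf\{\lambda>0:\int_0^1 M_2(|f|/\lambda)\,dm\le 1\}$ is finite, and let $G$ be the closure of $L^\infty$ in $L^{M_2}$. Let $r_k(t)=\operatorname{sign}\sin(2^k\pi t)$, $k\ge1$, and let $w_n=\prod_{i\ge 0} r_{i+1}^{\varepsilon_i}$ for $n=\sum_{i\ge0}\varepsilon_i2^i$, $\varepsilon_i\in\{0,1\}$, be the Walsh functions in Paley's numbering. For $q>1$, a sequence $(w_{n_k})_{k\ge1}$ with integers $n_k\ge 1$ is called $q$-lacunary if $n_{k+1}/n_k\ge q$ for all $k\ge1$. For a measurable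 set $E\subset[0,1]$ with $m(E)>0$, let $\rho_E(x)=m(E\cap[0,x])/m(E)$, let $\rho_E^{-1}(t)=\inf\{x\in[0,1]:\rho_E(x)\ge t\}$, and let $X|E$ be the space of measurable functions $f$ on $E$ for which $\|f\|_{X|E}=\|f\circ\rho_E^{-1}\|_X$ is finite. **Theorem.** Let $q>1$. To every measurable set $E\subset[0,1]$ of positive measure one can assign an $N=N(E,q)\in\mathbb N$ such that the following holds. For every r.i. space $X$ on $[0,1]$ with $G\subset X$ there are constants $A'(X,q),B'(X,q)>0$, depending only on $X$ and $q$, such that for every measurable set $E\subset[0,1]$ of positive measure, every $q$-lacunary sequence $(w_{n_k})$ of Walsh functions with $n_k\ge N(E,q)$ for all $k\ge1$, and every real sequence $(a_k)_{k\ge1}\in\ell^2$, the series $\sum_{k\ge1}a_kw_{n_k}$ converges in $L^2([0,1])$, the restriction of its sum to $E$ belongs to $X|E$, and $$A'(X,q)\Big(\sum_{k=1}^\infty a_k^2\Big)^{1/2}\le\Big\|\sum_{k\ge1}a_kw_{n_k}\Big\|_{X|E}\le B'(X,q)\Big(\sum_{k=1}^\infty a_k^2\Big)^{1/2}.$$ 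-/

import Mathlib

open MeasureTheory Set Filter Topology
open scoped unitInterval ENNReal

noncomputable section

namespace LacunaryWalsh

/-- Real measurable functions on `[0,1]` (with Lebesgue measure), modulo equality a.e. -/
abbrev L0 : Type := I →ₘ[(volume : Measure I)] ℝ

/-! ### Banach function spaces and rearrangement invariant spaces -/

/-- A Banach function space `X` on `[0,1]`. It is given by its extended norm `‖·‖_X` on the measurable
functions, with value `∞` exactly at the functions outside `X`; see `BanachFunctionSpace.carrier`
for the linear subspace `X` itself. -/
structure BanachFunctionSpace where
  extNorm : L0 → ℝ≥0∞
  extNorm_smul : ∀ (c : ℝ) (f : L0), extNorm (c • f) = ENNReal.ofReal |c| * extNorm f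
  extNorm_add_le : ∀ f g : L0, extNorm (f + g) ≤ extNorm f + extNorm g
  eq_zero_of_extNorm_eq_zero : ∀ f : L0, extNorm f = 0 → f = 0
  /-- The lattice (ideal) property. If `g ∈ X`, this gives `f ∈ X` and `‖f‖_X ≤ ‖g‖_X`. -/
  extNorm_mono : ∀ f g : L0, (∀ᵐ t, |f t| ≤ |g t|) → extNorm f ≤ extNorm g
  /-- Completeness: Cauchy sequences in `X` converge in `X`. -/
  complete : ∀ f : ℕ → L0, (∀ k, extNorm (f k) < ∞) →
    (∀ ε : ℝ≥0∞, 0 < ε → ∃ K, ∀ j ≥ K, ∀ k ≥ K, extNorm (f j - f k) ≤ ε) →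
    ∃ g : L0, extNorm g < ∞ ∧ Tendsto (fun k => extNorm (f k - g)) atTop (𝓝 0)

/-- The linear space `X` underlying a Banach function space. -/
def BanachFunctionSpace.carrier (X : BanachFunctionSpace) : Submodule ℝ L0 where
  carrier := {f | X.extNorm f < ∞}
  zero_mem' := by
    have h := X.extNorm_smul 0 0
    simp only [zero_smul, abs_zero, ENNReal.ofReal_zero, zero_mul] at h
    simp [h]
  add_mem' := fun {f g} hf hg =>
    lt_of_le_of_lt (X.extNorm_add_le f g) (ENNReal.add_lt_top.2 ⟨hf, hg⟩)
  smul_mem' := fun c f hf => by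
    change X.extNorm (c • f) < ∞
    rw [X.extNorm_smul]
    exact ENNReal.mul_lt_top ENNReal.ofReal_lt_top hf

/-- The distribution function `m_f(s) = m({t : |f(t)| > s})`. -/
def distribution (f : L0) (s : ℝ) : ℝ≥0∞ := volume {t : I | s < |f t|}

/-- `X` is rearrangement invariant: if `m_f = m_g` and `f ∈ X`, then `g ∈ X` and
`‖g‖_X = ‖f‖_X`. -/
def BanachFunctionSpace.IsRearrangementInvariant (X : BanachFunctionSpace) : Prop :=
  ∀ f g : L0, (∀ s : ℝ, 0 < s → distribution f s = distribution g s) → f ∈ X.carrier →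
    g ∈ X.carrier ∧ X.extNorm g = X.extNorm f

/-! ### The Orlicz space generated by `exp(t²) - 1` and the space `G` -/

/-- The (Luxemburg) norm of the Orlicz space generated by `Φ`; it is `∞` if no `c` is admissible. -/
def orliczNorm (Φ : ℝ → ℝ) (f : L0) : ℝ≥0∞ :=
  ⨅ (c : ℝ) (_ : 0 < c ∧ ∫⁻ t : I, ENNReal.ofReal (Φ (|f t| / c)) ≤ 1), ENNReal.ofReal c

/-- `M₂(t) = exp(t²) - 1`. -/
def M2 (t : ℝ) : ℝ := Real.exp (t ^ 2) - 1

/-- The space `G`: the closure of `L^∞` in the Orlicz space `L^{M₂}`. -/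
def spaceG : Set L0 :=
  {f | orliczNorm M2 f < ∞ ∧
    ∀ ε : ℝ≥0∞, 0 < ε → ∃ g : L0, g ∈ Lp ℝ ∞ (volume : Measure I) ∧ orliczNorm M2 (f - g) ≤ ε}

/-! ### The Walsh system in Paley's numbering -/

/-- The Rademacher functions `r_k(t) = sign sin(2^k π t)`, `k ≥ 1`. -/
def rademacher (k : ℕ) (t : I) : ℝ := Real.sign (Real.sin (2 ^ k * Real.pi * (t : ℝ)))

/-- The Walsh functions: `w_k = ∏ r_{i+1}` over the positions `i` of the binary digits `1` of `k`. -/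
def walsh (k : ℕ) (t : I) : ℝ :=
  ∏ i ∈ Finset.range k.size, if k.testBit i then rademacher (i + 1) t else 1

theorem measurable_rademacher (k : ℕ) : Measurable (rademacher k) := by
  have hs : Measurable Real.sign := by
    unfold Real.sign
    exact Measurable.ite measurableSet_Iio measurable_const
      (Measurable.ite measurableSet_Ioi measurable_const measurable_const)
  exact hs.comp (by fun_prop)

theorem abs_rademacher_le (k : ℕ) (t : I) : |rademacher k t| ≤ 1 := by
  unfold rademacher
  rcases Real.sign_apply_eq (Real.sin (2 ^ k * Real.pi * (t : ℝ))) with h | h | h <;> simp [h]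

theorem measurable_walsh (k : ℕ) : Measurable (walsh k) := by
  unfold walsh
  refine Finset.measurable_fun_prod _ fun i _ => ?_
  split_ifs
  · exact measurable_rademacher _
  · exact measurable_const

theorem abs_walsh_le (k : ℕ) (t : I) : |walsh k t| ≤ 1 := by
  unfold walsh
  rw [Finset.abs_prod]
  refine Finset.prod_le_one (fun _ _ => abs_nonneg _) fun i _ => ?_
  split_ifs
  · exact abs_rademacher_le _ _
  · simp

theorem memLp_walsh (k : ℕ) : MemLp (walsh k) 2 (volume : Measure I) :=
  MemLp.of_bound (measurable_walsh k).aestronglyMeasurable 1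
    (Eventually.of_forall fun t => abs_walsh_le k t)

/-- The Walsh function `w_k` as an element of `L²([0,1])`. -/
def walshL2 (k : ℕ) : Lp ℝ 2 (volume : Measure I) := (memLp_walsh k).toLp (walsh k)

/-- `(w_{n_k})` is `q`-lacunary: `n_{k+1} / n_k ≥ q` for all `k`, the `n_k` being positive. -/
def IsLacunary (q : ℝ) (n : ℕ → ℕ) : Prop :=
  ∀ k, 0 < n k ∧ q ≤ (n (k + 1) : ℝ) / (n k : ℝ)

/-! ### The local space `X|E` -/

/-- `ρ_E(x) = m(E ∩ [0,x]) / m(E)`. -/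
def rho (E : Set I) (x : I) : ℝ := volume.real (E ∩ Iic x) / volume.real E

/-- The left continuous inverse of `ρ_E`, namely `t ↦ inf {x ∈ [0,1] : ρ_E(x) ≥ t}`. -/
def rhoInv (E : Set I) (t : I) : I := sInf {x : I | (t : ℝ) ≤ rho E x}

theorem rho_mono (E : Set I) : Monotone (rho E) := fun x y h => by
  unfold rho
  gcongr
  exact measure_ne_top _ _

theorem rho_sub_le (E : Set I) {x y : I} (h : x ≤ y) :
    rho E y - rho E x ≤ ((y : ℝ) - x) / volume.real E := by
  unfold rho
  rw [← sub_div]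
  refine div_le_div_of_nonneg_right ?_ measureReal_nonneg
  have h1 : E ∩ Iic y ⊆ (E ∩ Iic x) ∪ Ioc x y := by
    rintro z ⟨hz, hzy⟩
    by_cases hzx : z ≤ x
    · exact Or.inl ⟨hz, hzx⟩
    · exact Or.inr ⟨not_le.1 hzx, hzy⟩
  have h2 := (measureReal_mono h1 (measure_ne_top volume _)).trans (measureReal_union_le _ _)
  have h3 : volume.real (Ioc x y) = (y : ℝ) - x := by
    rw [Measure.real, unitInterval.volume_Ioc, ENNReal.toReal_ofReal (sub_nonneg.2 h)]
  linarith

theorem rhoInv_le_iff {E : Set I} (hE : 0 < volume E) (t x : I) :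
    rhoInv E t ≤ x ↔ (t : ℝ) ≤ rho E x := by
  have hEr : 0 < volume.real E := ENNReal.toReal_pos hE.ne' (measure_ne_top _ _)
  constructor
  · intro h
    refine le_of_forall_pos_le_add fun ε hε => ?_
    have hmem : (1 : I) ∈ {x : I | (t : ℝ) ≤ rho E x} := by
      have : Iic (1 : I) = univ := eq_univ_of_forall fun z => z.2.2
      change (t : ℝ) ≤ rho E 1
      rw [rho, this, inter_univ, div_self hEr.ne']
      exact t.2.2
    by_cases hx1 : x = 1
    · subst hx1
      exact hmem.trans (by linarith)
    have hx1' : (x : ℝ) < 1 := lt_of_le_of_ne x.2.2 fun h => hx1 (Subtype.ext h)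
    let y : I := ⟨min 1 (x + ε * volume.real E),
      le_min zero_le_one (add_nonneg x.2.1 (by positivity)), min_le_left _ _⟩
    have hxy : x < y := by
      change (x : ℝ) < min 1 (x + ε * volume.real E)
      exact lt_min hx1' (by linarith [mul_pos hε hEr])
    obtain ⟨z, hz, hzy⟩ := (sInf_lt_iff (b := y)).1 (lt_of_le_of_lt h hxy)
    have h1 : rho E y - rho E x ≤ ε := by
      refine (rho_sub_le E hxy.le).trans ?_
      rw [div_le_iff₀ hEr]
      have : (y : ℝ) ≤ x + ε * volume.real E := min_le_right _ _
      linarith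
    have h2 : (t : ℝ) ≤ rho E y := le_trans hz (rho_mono E hzy.le)
    linarith
  · intro h
    exact sInf_le h

theorem measurable_rhoInv {E : Set I} (hE : 0 < volume E) : Measurable (rhoInv E) := by
  refine measurable_of_Iic fun x => ?_
  have : rhoInv E ⁻¹' Iic x = {t : I | (t : ℝ) ≤ rho E x} := by
    ext t
    exact rhoInv_le_iff hE t x
  rw [this]
  exact measurableSet_le measurable_subtype_coe measurable_const

/-- `ρ_E⁻¹` carries Lebesgue measure on `[0,1]` to the normalized Lebesgue measure on `E`. -/
theorem map_rhoInv {E : Set I} (hE : 0 < volume E) :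
    Measure.map (rhoInv E) (volume : Measure I) = (volume E)⁻¹ • volume.restrict E := by
  have hEr : 0 < volume.real E := ENNReal.toReal_pos hE.ne' (measure_ne_top _ _)
  have : IsProbabilityMeasure (Measure.map (rhoInv E) (volume : Measure I)) :=
    Measure.isProbabilityMeasure_map (measurable_rhoInv hE).aemeasurable
  refine Measure.ext_of_Iic _ _ fun x => ?_
  rw [Measure.map_apply (measurable_rhoInv hE) measurableSet_Iic, Measure.smul_apply,
    Measure.restrict_apply measurableSet_Iic, smul_eq_mul]
  have h0 : 0 ≤ rho E x := by unfold rho; positivity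
  have h1 : rho E x ≤ 1 := by
    unfold rho
    rw [div_le_one hEr]
    exact measureReal_mono inter_subset_left (measure_ne_top _ _)
  have hset : rhoInv E ⁻¹' Iic x = Iic (⟨rho E x, h0, h1⟩ : I) := by
    ext t
    exact rhoInv_le_iff hE t x
  rw [hset, unitInterval.volume_Iic]
  change ENNReal.ofReal (volume.real (E ∩ Iic x) / volume.real E) = _
  rw [ENNReal.ofReal_div_of_pos hEr, Measure.real, Measure.real,
    ENNReal.ofReal_toReal (measure_ne_top _ _), ENNReal.ofReal_toReal (measure_ne_top _ _),
    ENNReal.div_eq_inv_mul, inter_comm]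

theorem quasiMeasurePreserving_rhoInv {E : Set I} (hE : 0 < volume E) :
    Measure.QuasiMeasurePreserving (rhoInv E) (volume : Measure I) (volume.restrict E) :=
  ⟨measurable_rhoInv hE, by
    rw [map_rhoInv hE]
    exact Measure.smul_absolutelyContinuous⟩

/-- Real measurable functions on `E`, modulo equality a.e. on `E`. -/
abbrev L0On (E : Set I) : Type := I →ₘ[(volume : Measure I).restrict E] ℝ

/-- The restriction of a function on `[0,1]` to `E`. -/
def restrictTo (E : Set I) (f : L0) : L0On E := AEEqFun.mk f f.aestronglyMeasurable.restrict

/-- The norm of the local space `X|E`: `‖f‖_{X|E} = ‖f ∘ ρ_E⁻¹‖_X` for measurable `f` on `E`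
(`∞` if `f ∉ X|E`). -/
def BanachFunctionSpace.localNorm (X : BanachFunctionSpace) (E : Set I) (hE : 0 < volume E)
    (f : L0On E) : ℝ≥0∞ :=
  X.extNorm (f.compQuasiMeasurePreserving (rhoInv E) (quasiMeasurePreserving_rhoInv hE))

end LacunaryWalsh

end

noncomputable section

namespace LacunaryWalsh

/-! Choose `L` with `2 ≤ q ^ L`. Along each residue class of indices mod `L` the frequencies at
least double, so their highest binary digits are distinct. Walsh functions with distinct highest
digits behave like independent signs, even against a weight `φ` constant on dyadic intervals of
length `2⁻ˡ`, provided all frequencies are at least `2 ^ l`. Jensen over the `L` classes gives a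
subgaussian bound for finite sums under `φ` (`integral_mul_exp_walshSum_le`), and then integrability
of the exponential of their squares (`integral_mul_exp_sq_le`).

A set `E` enters through an L² approximation of its indicator by such a `φ`. The error is paid for
by second moments on the whole interval, which the subgaussian bound also controls; the threshold
`N` depends on `l` and hence on `E`, the resulting constants only on `L`. For the quadratic lower
bound, a product of two terms is the Walsh function of index `n j ^^^ n k ≥ |n k - n j|`; lacunarity
makes this large, so the product is orthogonal to `φ`. This is `exists_local_bounds`.

Since `ρ_E⁻¹` carries Lebesgue measure to normalized measure on `E`, the estimates transfer to
functions on `[0,1]`. Upper bound: the sum is approximated by bounded partial sums with small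
subgaussian tails, so it lies in `G` (`LocallySubgaussian.allSqExpMoments`), and `G ⊆ X` is
automatically a bounded embedding (`exists_extNorm_le_of_spaceG_subset`). Lower bound: by a
Paley–Zygmund argument (`le_measureReal_lt_sq`) a finite sum exceeds half its ℓ² norm on a fixed
proportion of `E`, so rearrangement invariance bounds its norm below by that of a multiple of a
fixed indicator (`exists_mul_le_extNorm`). The upper bound applied to tails extends this to infinite
sums. -/

/-! ### Dyadic intervals and functions that are constant on them -/

/-- The index of the half-open dyadic interval of length `2⁻ʲ` that contains `t`. -/
def cell (j : ℕ) (t : I) : ℕ := ⌊(2 : ℝ) ^ j * (t : ℝ)⌋₊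

theorem measurable_cell (j : ℕ) : Measurable (cell j) := by
  unfold cell
  fun_prop

theorem cell_eq_iff (j m : ℕ) (t : I) :
    cell j t = m ↔ (m : ℝ) ≤ 2 ^ j * (t : ℝ) ∧ 2 ^ j * (t : ℝ) < m + 1 := by
  unfold cell
  exact Nat.floor_eq_iff (mul_nonneg (by positivity) t.2.1)

/-- Equality occurs at the endpoint `t = 1`, which forms an extra cell of measure zero. -/
theorem cell_le (j : ℕ) (t : I) : cell j t ≤ 2 ^ j := by
  unfold cell
  refine Nat.floor_le_of_le ?_
  push_cast
  exact mul_le_of_le_one_right (by positivity) t.2.2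

theorem cell_succ_div_two (j : ℕ) (t : I) : cell (j + 1) t / 2 = cell j t := by
  unfold cell
  rw [← Nat.floor_div_ofNat]
  congr 1
  rw [pow_succ]
  ring

theorem cell_mono {i j : ℕ} (h : i ≤ j) {s t : I} (hst : cell j s = cell j t) :
    cell i s = cell i t := by
  induction j, h using Nat.le_induction with
  | base => exact hst
  | succ k _ ih => exact ih (by rw [← cell_succ_div_two, hst, cell_succ_div_two])

theorem abs_sub_lt_of_cell_eq {j : ℕ} {s t : I} (h : cell j s = cell j t) :
    |(s : ℝ) - t| < 1 / 2 ^ j := by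
  obtain ⟨h1, h2⟩ := (cell_eq_iff j _ s).1 rfl
  obtain ⟨h3, h4⟩ := (cell_eq_iff j _ t).1 rfl
  rw [h] at h1 h2
  rw [lt_div_iff₀ (by positivity), ← abs_of_pos (show (0 : ℝ) < 2 ^ j by positivity), ← abs_mul,
    abs_lt]
  constructor <;> linarith

theorem volume_real_cell_eq {j m : ℕ} (hm : m < 2 ^ j) :
    volume.real {t : I | cell j t = m} = 1 / 2 ^ j := by
  have hm' : (m : ℝ) + 1 ≤ 2 ^ j := by exact_mod_cast hm
  have h2 : (0 : ℝ) < 2 ^ j := by positivity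
  have hset : {t : I | cell j t = m} =
      Ico (⟨m / 2 ^ j, by positivity, by rw [div_le_one h2]; linarith⟩ : I)
        ⟨(m + 1) / 2 ^ j, by positivity, by rwa [div_le_one h2]⟩ := by
    ext t
    rw [mem_ofPred_eq, cell_eq_iff, mem_Ico, ← Subtype.coe_le_coe, ← Subtype.coe_lt_coe,
      div_le_iff₀ h2, lt_div_iff₀ h2, mul_comm]
  rw [hset, Measure.real, unitInterval.volume_Ico, ← sub_div, add_sub_cancel_left,
    ENNReal.toReal_ofReal (by positivity)]

theorem integral_comp_cell (j : ℕ) (h : ℕ → ℝ) :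
    ∫ t : I, h (cell j t) = (∑ m ∈ Finset.range (2 ^ j), h m) / 2 ^ j := by
  have hmeas : ∀ m, MeasurableSet {t : I | cell j t = m} := fun m =>
    measurable_cell j (measurableSet_singleton m)
  have hae : (fun t : I => h (cell j t)) =ᵐ[volume] fun t =>
      ∑ m ∈ Finset.range (2 ^ j), {t : I | cell j t = m}.indicator (fun _ => h m) t := by
    have h1 : ∀ᵐ t : I, t ≠ 1 := by
      rw [ae_iff]
      simp
    filter_upwards [h1] with t ht
    have ht1 : (t : ℝ) < 1 := lt_of_le_of_ne t.2.2 fun h => ht (Subtype.ext h)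
    have hlt : cell j t < 2 ^ j := by
      unfold cell
      rw [Nat.floor_lt (mul_nonneg (by positivity) t.2.1)]
      push_cast
      exact mul_lt_of_lt_one_right (by positivity) ht1
    rw [Finset.sum_eq_single (cell j t)]
    · simp
    · intro b _ hb
      exact indicator_of_notMem (fun hmem => hb hmem.symm) _
    · intro hn
      exact absurd (Finset.mem_range.2 hlt) hn
  rw [integral_congr_ae hae, integral_finsetSum _ fun m _ =>
    (integrable_const (h m)).indicator (hmeas m), Finset.sum_div]
  refine Finset.sum_congr rfl fun m hm => ?_
  rw [integral_indicator_const _ (hmeas m), volume_real_cell_eq (Finset.mem_range.1 hm),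
    smul_eq_mul]
  ring

/-- `g` is constant on the dyadic intervals of length `2⁻ʲ`. -/
abbrev DyadicStep (j : ℕ) (g : I → ℝ) : Prop := g.FactorsThrough (cell j)

namespace DyadicStep

variable {i j : ℕ} {f g : I → ℝ}

theorem mono (h : i ≤ j) (hg : DyadicStep i g) : DyadicStep j g :=
  fun _ _ hst => hg (cell_mono h hst)

theorem comp (hg : DyadicStep j g) (φ : ℝ → ℝ) : DyadicStep j fun t => φ (g t) :=
  fun _ _ hst => congrArg φ (hg hst)

theorem const (c : ℝ) : DyadicStep j fun _ => c := fun _ _ _ => rfl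

theorem mul (hf : DyadicStep j f) (hg : DyadicStep j g) : DyadicStep j fun t => f t * g t :=
  fun _ _ hst => congrArg₂ (· * ·) (hf hst) (hg hst)

theorem add (hf : DyadicStep j f) (hg : DyadicStep j g) : DyadicStep j fun t => f t + g t :=
  fun _ _ hst => congrArg₂ (· + ·) (hf hst) (hg hst)

theorem prod {ι : Type*} {s : Finset ι} {F : ι → I → ℝ} (h : ∀ k ∈ s, DyadicStep j (F k)) :
    DyadicStep j fun t => ∏ k ∈ s, F k t :=
  fun _ _ hst => Finset.prod_congr rfl fun k hk => h k hk hst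

theorem sum {ι : Type*} {s : Finset ι} {F : ι → I → ℝ} (h : ∀ k ∈ s, DyadicStep j (F k)) :
    DyadicStep j fun t => ∑ k ∈ s, F k t :=
  fun _ _ hst => Finset.sum_congr rfl fun k hk => h k hk hst

theorem exists_eq (hg : DyadicStep j g) : ∃ h : ℕ → ℝ, ∀ t, g t = h (cell j t) := by
  obtain ⟨h, rfl⟩ := (Function.factorsThrough_iff g).1 hg
  exact ⟨h, fun _ => rfl⟩

theorem measurable (hg : DyadicStep j g) : Measurable g := by
  obtain ⟨h, hh⟩ := hg.exists_eq
  rw [funext hh]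
  exact (measurable_of_countable h).comp (measurable_cell j)

theorem exists_bound (hg : DyadicStep j g) : ∃ C, ∀ t, |g t| ≤ C := by
  obtain ⟨h, hh⟩ := hg.exists_eq
  refine ⟨∑ m ∈ Finset.range (2 ^ j + 1), |h m|, fun t => ?_⟩
  rw [hh]
  exact Finset.single_le_sum (f := fun m => |h m|) (fun _ _ => abs_nonneg _)
    (Finset.mem_range.2 (Nat.lt_succ_of_le (cell_le j t)))

theorem integrable (hg : DyadicStep j g) : Integrable g (volume : Measure I) := by
  obtain ⟨C, hC⟩ := hg.exists_bound
  exact Integrable.of_bound hg.measurable.aestronglyMeasurable C (ae_of_all _ hC)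

end DyadicStep

/-! ### Walsh functions as exact signs -/

/-- The right continuous version of the Rademacher function `r_k`, with values `±1`. -/
def radSign (k : ℕ) (t : I) : ℝ := (-1) ^ cell k t

/-- The right continuous version of the Walsh function `w_n`, with values `±1`. -/
def walshSign (n : ℕ) (t : I) : ℝ :=
  ∏ i ∈ Finset.range n.size, if n.testBit i then radSign (i + 1) t else 1

theorem dyadicStep_radSign (k : ℕ) : DyadicStep k (radSign k) :=
  fun s t h => by unfold radSign; rw [h]

theorem radSign_mul_self (k : ℕ) (t : I) : radSign k t * radSign k t = 1 := by
  unfold radSign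
  rw [← mul_pow]
  norm_num

theorem rademacher_eq_radSign {k : ℕ} {t : I} (h : ∀ m : ℕ, (2 : ℝ) ^ k * (t : ℝ) ≠ m) :
    rademacher k t = radSign k t := by
  obtain ⟨h1, h2⟩ := (cell_eq_iff k _ t).1 rfl
  have h1' := lt_of_le_of_ne h1 (h _).symm
  unfold rademacher radSign
  set m := cell k t
  have hx : (2 : ℝ) ^ k * Real.pi * t = (2 ^ k * t - m) * Real.pi + m * Real.pi := by ring
  rw [hx, Real.sin_add_nat_mul_pi]
  have hpos : 0 < Real.sin ((2 ^ k * t - m) * Real.pi) := by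
    refine Real.sin_pos_of_pos_of_lt_pi (mul_pos (by linarith) Real.pi_pos) ?_
    exact mul_lt_of_lt_one_left Real.pi_pos (by linarith)
  rcases neg_one_pow_eq_or ℝ m with h | h
  · rw [h, one_mul, Real.sign_of_pos hpos]
  · rw [h, Real.sign_of_neg (by linarith)]

theorem ae_forall_two_pow_mul_ne : ∀ᵐ t : I, ∀ k m : ℕ, (2 : ℝ) ^ k * (t : ℝ) ≠ m := by
  rw [ae_all_iff]
  intro k
  rw [ae_all_iff]
  intro m
  rw [ae_iff]
  simp only [not_not]
  refine Set.Subsingleton.measure_zero (fun s hs t ht => ?_) _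
  refine Subtype.ext (mul_left_cancel₀ (show (2 : ℝ) ^ k ≠ 0 by positivity) ?_)
  exact Eq.trans hs (Eq.symm ht)

/-- The two versions can differ only at dyadic rationals, where the sine may vanish. Working with
exact signs makes the algebraic identities below hold everywhere. -/
theorem walsh_ae_eq_walshSign (n : ℕ) : walsh n =ᵐ[volume] walshSign n := by
  filter_upwards [ae_forall_two_pow_mul_ne] with t ht
  unfold walsh walshSign
  refine Finset.prod_congr rfl fun i _ => ?_
  rw [rademacher_eq_radSign (ht _)]

theorem walshSign_eq_prod_range {n M : ℕ} (h : n < 2 ^ M) (t : I) :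
    walshSign n t = ∏ i ∈ Finset.range M, if n.testBit i then radSign (i + 1) t else 1 := by
  unfold walshSign
  refine Finset.prod_subset (Finset.range_subset_range.2 (Nat.size_le.2 h)) fun i _ hi => ?_
  rw [Finset.mem_range, not_lt, Nat.size_le] at hi
  rw [Nat.testBit_lt_two_pow hi]
  simp

theorem walshSign_mul (n m : ℕ) (t : I) :
    walshSign n t * walshSign m t = walshSign (n ^^^ m) t := by
  obtain ⟨M, hn, hm⟩ : ∃ M, n < 2 ^ M ∧ m < 2 ^ M :=
    ⟨n + m, (Nat.lt_two_pow_self).trans_le (Nat.pow_le_pow_right two_pos (by omega)),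
      (Nat.lt_two_pow_self).trans_le (Nat.pow_le_pow_right two_pos (by omega))⟩
  rw [walshSign_eq_prod_range hn, walshSign_eq_prod_range hm,
    walshSign_eq_prod_range (Nat.xor_lt_two_pow hn hm), ← Finset.prod_mul_distrib]
  refine Finset.prod_congr rfl fun i _ => ?_
  rw [Nat.testBit_xor]
  cases n.testBit i <;> cases m.testBit i <;> simp [radSign_mul_self]

@[simp] theorem walshSign_zero (t : I) : walshSign 0 t = 1 := by simp [walshSign]

theorem walshSign_eq_one_or (n : ℕ) (t : I) : walshSign n t = 1 ∨ walshSign n t = -1 := by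
  have h := walshSign_mul n n t
  rw [Nat.xor_self, walshSign_zero] at h
  exact mul_self_eq_one_iff.1 h

theorem dyadicStep_walshSign {n j : ℕ} (h : n < 2 ^ j) : DyadicStep j (walshSign n) := by
  rw [funext (walshSign_eq_prod_range h)]
  refine DyadicStep.prod fun i hi => ?_
  split_ifs
  · exact (dyadicStep_radSign _).mono (Finset.mem_range.1 hi)
  · exact DyadicStep.const 1

/-- The two halves of every cell of level `j` carry opposite signs and cancel. -/
theorem integral_mul_radSign_succ {j : ℕ} {g : I → ℝ} (hg : DyadicStep j g) :
    ∫ t, g t * radSign (j + 1) t = 0 := by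
  obtain ⟨h, hh⟩ := hg.exists_eq
  have h1 : ∀ t, g t * radSign (j + 1) t =
      (fun m : ℕ => h (m / 2) * (-1) ^ m) (cell (j + 1) t) := fun t => by
    simp only [hh, radSign, cell_succ_div_two]
  have h2 : ∀ N : ℕ, ∑ m ∈ Finset.range (2 * N), h (m / 2) * (-1 : ℝ) ^ m = 0 := by
    intro N
    induction N with
    | zero => simp
    | succ N ih =>
      rw [show 2 * (N + 1) = 2 * N + 1 + 1 by ring, Finset.sum_range_succ, Finset.sum_range_succ,
        ih, show 2 * N / 2 = N by omega, show (2 * N + 1) / 2 = N by omega, pow_succ, pow_mul]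
      simp
  refine (integral_congr_ae (ae_of_all _ h1)).trans
    ((integral_comp_cell (j + 1) fun m => h (m / 2) * (-1) ^ m).trans ?_)
  rw [pow_succ', h2, zero_div]

/-- The highest digit of `n` sits at some position `k ≥ j`. Splitting off its Rademacher factor
leaves a step function of level `k`. -/
theorem integral_mul_walshSign {j n : ℕ} {g : I → ℝ} (hg : DyadicStep j g) (hn : 2 ^ j ≤ n) :
    ∫ t, g t * walshSign n t = 0 := by
  have hn0 : n ≠ 0 := (lt_of_lt_of_le (by positivity) hn).ne'
  set k := Nat.log 2 n with hk
  have hlt : n < 2 ^ (k + 1) := Nat.lt_pow_succ_log_self one_lt_two n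
  have hle : 2 ^ k ≤ n := Nat.pow_log_le_self 2 hn0
  have hjk : j ≤ k := (Nat.le_log_iff_pow_le one_lt_two hn0).2 hn
  have hbit : n.testBit k = true := Nat.testBit_of_two_pow_le_and_two_pow_add_one_gt hle hlt
  have h1 : ∀ t, g t * walshSign n t =
      (g t * ∏ i ∈ Finset.range k, if n.testBit i then radSign (i + 1) t else 1) *
        radSign (k + 1) t := fun t => by
    rw [walshSign_eq_prod_range hlt, Finset.prod_range_succ, hbit, if_pos rfl, mul_assoc]
  simp_rw [h1]
  refine integral_mul_radSign_succ ((hg.mono hjk).mul (DyadicStep.prod fun i hi => ?_))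
  split_ifs
  · exact (dyadicStep_radSign _).mono (Finset.mem_range.1 hi)
  · exact DyadicStep.const 1

/-- Addition without carries never exceeds addition. This turns a gap between two frequencies into a
lower bound for the frequency of their product. -/
theorem le_add_xor (m n : ℕ) : n ≤ m + (m ^^^ n) := by
  have h : ∀ a b : ℕ, a ^^^ b ≤ a + b := by
    intro a
    induction a using Nat.strong_induction_on with
    | _ a ih =>
      intro b
      rcases Nat.eq_zero_or_pos a with rfl | ha
      · simp
      have h1 := ih (a / 2) (by omega) (b / 2)
      have h2 := Nat.xor_div_two (a := a) (b := b)
      have h3 := Nat.xor_mod_two_eq (m := a) (n := b)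
      omega
  calc n = m ^^^ (m ^^^ n) := by rw [← Nat.xor_assoc, Nat.xor_self, Nat.zero_xor]
    _ ≤ _ := h _ _

/-! ### Exponential and moment bounds for finite Walsh sums -/

/-- A finite Walsh sum. -/
def walshSum (a : ℕ → ℝ) (n : ℕ → ℕ) (F : Finset ℕ) (t : I) : ℝ :=
  ∑ k ∈ F, a k * walshSign (n k) t

theorem exists_dyadicStep_walshSum (a : ℕ → ℝ) (n : ℕ → ℕ) (F : Finset ℕ) (l : ℕ) :
    ∃ J, l ≤ J ∧ DyadicStep J (walshSum a n F) := by
  refine ⟨l + ∑ k ∈ F, n k, by omega, ?_⟩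
  unfold walshSum
  refine DyadicStep.sum fun k hk => (DyadicStep.const (a k)).mul (dyadicStep_walshSign ?_)
  have : n k ≤ ∑ k ∈ F, n k := Finset.single_le_sum (f := n) (fun _ _ => Nat.zero_le _) hk
  exact Nat.lt_two_pow_self.trans_le (Nat.pow_le_pow_right two_pos (by omega))

/-- On the values `±1` the exponential is affine, so the exponential of a Walsh sum becomes a
product to which independence applies. -/
theorem exp_mul_walshSign (x : ℝ) (n : ℕ) (t : I) :
    Real.exp (x * walshSign n t) = Real.cosh x + Real.sinh x * walshSign n t := by
  rcases walshSign_eq_one_or n t with h | h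
  · rw [h, mul_one, mul_one, Real.cosh_add_sinh]
  · rw [h, mul_neg_one, mul_neg_one, ← sub_eq_add_neg, Real.cosh_sub_sinh]

/-- Walsh functions with distinct highest digits are independent, also of the lower digits. -/
theorem integral_mul_prod_walshSign {l : ℕ} {φ : I → ℝ} (hφ : DyadicStep l φ) (n : ℕ → ℕ)
    (c s : ℕ → ℝ) (F : Finset ℕ) (hn : ∀ k ∈ F, 2 ^ l ≤ n k)
    (hinj : Set.InjOn (fun k => Nat.log 2 (n k)) F) :
    ∫ t, φ t * ∏ k ∈ F, (c k + s k * walshSign (n k) t) = (∫ t, φ t) * ∏ k ∈ F, c k := by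
  -- Removing the index with the highest top digit leaves a step function of level `j`, and the
  -- removed Walsh function integrates to zero against it.
  induction F using Finset.induction_on_max_value (fun k => Nat.log 2 (n k)) with
  | empty => simp
  | insert m F hm hmax ih =>
    have ih' := ih (fun k hk => hn k (Finset.mem_insert_of_mem hk))
      (hinj.mono (by simp))
    have hnm := hn m (Finset.mem_insert_self _ _)
    have hnm0 : n m ≠ 0 := (lt_of_lt_of_le (by positivity) hnm).ne'
    set j := Nat.log 2 (n m) with hj
    have hlj : l ≤ j := (Nat.le_log_iff_pow_le one_lt_two hnm0).2 hnm
    have hstep : DyadicStep j fun t => φ t * ∏ k ∈ F, (c k + s k * walshSign (n k) t) := by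
      refine (hφ.mono hlj).mul (DyadicStep.prod fun k hk => (DyadicStep.const _).add
        ((DyadicStep.const _).mul (dyadicStep_walshSign ?_)))
      have hne : Nat.log 2 (n k) ≠ j := fun h => hm (by
        have := hinj (Finset.mem_coe.2 (Finset.mem_insert_of_mem hk))
          (Finset.mem_coe.2 (Finset.mem_insert_self m F)) h
        rwa [← this])
      have hlt : Nat.log 2 (n k) < j := lt_of_le_of_ne (hmax k hk) hne
      exact Nat.lt_pow_of_log_lt one_lt_two hlt
    have hmS : DyadicStep (j + 1) (walshSign (n m)) :=
      dyadicStep_walshSign (Nat.lt_pow_succ_log_self one_lt_two _)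
    have h0 := integral_mul_walshSign hstep (Nat.pow_log_le_self 2 hnm0)
    calc ∫ t, φ t * ∏ k ∈ insert m F, (c k + s k * walshSign (n k) t)
        = ∫ t, (c m * (φ t * ∏ k ∈ F, (c k + s k * walshSign (n k) t)) +
          s m * ((φ t * ∏ k ∈ F, (c k + s k * walshSign (n k) t)) * walshSign (n m) t)) := by
          refine integral_congr_ae (ae_of_all _ fun t => ?_)
          simp only [Finset.prod_insert hm]
          ring
      _ = _ := by
          rw [integral_add (hstep.integrable.const_mul _)
            (((hstep.mono (Nat.le_succ j)).mul hmS).integrable.const_mul _),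
            integral_const_mul, integral_const_mul, h0, ih', Finset.prod_insert hm]
          ring

/-- By independence the integral factors into `cosh (x * a k)`, and `cosh y ≤ exp (y ^ 2 / 2)`. -/
theorem integral_mul_exp_walshSum_le_of_injOn {l : ℕ} {φ : I → ℝ} (hφ : DyadicStep l φ)
    (hφ0 : ∀ t, 0 ≤ φ t) (n : ℕ → ℕ) (a : ℕ → ℝ) (F : Finset ℕ) (hn : ∀ k ∈ F, 2 ^ l ≤ n k)
    (hinj : Set.InjOn (fun k => Nat.log 2 (n k)) F) (x : ℝ) :
    ∫ t, φ t * Real.exp (x * walshSum a n F t) ≤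
      (∫ t, φ t) * Real.exp (x ^ 2 * (∑ k ∈ F, a k ^ 2) / 2) := by
  have h1 : ∀ t, Real.exp (x * walshSum a n F t) =
      ∏ k ∈ F, (Real.cosh (x * a k) + Real.sinh (x * a k) * walshSign (n k) t) := fun t => by
    rw [walshSum, Finset.mul_sum, Real.exp_sum]
    refine Finset.prod_congr rfl fun k _ => ?_
    rw [← exp_mul_walshSign, mul_assoc]
  simp_rw [h1]
  rw [integral_mul_prod_walshSign hφ n _ _ F hn hinj]
  refine mul_le_mul_of_nonneg_left ?_ (integral_nonneg hφ0)
  rw [Finset.mul_sum, Finset.sum_div, Real.exp_sum]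
  refine Finset.prod_le_prod (fun k _ => (Real.cosh_pos _).le) fun k _ => ?_
  rw [← mul_pow]
  exact Real.cosh_le_exp_half_sq _

/-- Within a residue class each step at least doubles the frequency and so raises its highest digit.
-/
theorem log_injOn_residueClass {L : ℕ} {n : ℕ → ℕ} (hpos : ∀ k, 0 < n k)
    (hL : ∀ k, 2 * n k ≤ n (k + L)) (i : ℕ) :
    Set.InjOn (fun k => Nat.log 2 (n k)) {k | k % L = i} := by
  have hstep : ∀ k m, 2 * n k ≤ n (k + L * (m + 1)) := by
    intro k m
    induction m with
    | zero => simpa using hL k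
    | succ m ih =>
      have := hL (k + L * (m + 1))
      rw [show k + L * (m + 1 + 1) = k + L * (m + 1) + L by ring]
      omega
  have hlt : ∀ k k', k < k' → k % L = i → k' % L = i → Nat.log 2 (n k) < Nat.log 2 (n k') := by
    intro k k' hkk h h'
    obtain ⟨m, hm⟩ := (Nat.modEq_iff_dvd' hkk.le).1 (h.trans h'.symm)
    rcases m with _ | m
    · omega
    have h2 := hstep k m
    rw [← hm, Nat.add_sub_cancel' hkk.le] at h2
    calc Nat.log 2 (n k) < Nat.log 2 (n k) + 1 := Nat.lt_succ_self _
      _ = Nat.log 2 (n k * 2) := (Nat.log_mul_base one_lt_two (hpos k).ne').symm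
      _ ≤ _ := Nat.log_mono_right (by omega)
  intro k hk k' hk' h
  rcases lt_trichotomy k k' with h1 | h1 | h1
  · exact absurd h (hlt _ _ h1 hk hk').ne
  · exact h1
  · exact absurd h (hlt _ _ h1 hk' hk).ne'

/-- The sum is the average of `L` times its parts over the residue classes. Convexity of `exp`
reduces to one class, with `x` replaced by `L * x`; hence the factor `L ^ 2`. -/
theorem integral_mul_exp_walshSum_le {l L : ℕ} (hL0 : 0 < L) {φ : I → ℝ} (hφ : DyadicStep l φ)
    (hφ0 : ∀ t, 0 ≤ φ t) {n : ℕ → ℕ} (hL : ∀ k, 2 * n k ≤ n (k + L)) (hn : ∀ k, 2 ^ l ≤ n k)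
    (a : ℕ → ℝ) (F : Finset ℕ) (x : ℝ) :
    ∫ t, φ t * Real.exp (x * walshSum a n F t) ≤
      (∫ t, φ t) * Real.exp (L ^ 2 * (∑ k ∈ F, a k ^ 2) * x ^ 2 / 2) := by
  have hpos : ∀ k, 0 < n k := fun k => lt_of_lt_of_le (by positivity) (hn k)
  have hLr : (0 : ℝ) < L := by exact_mod_cast hL0
  set G : ℕ → Finset ℕ := fun i => F.filter fun k => k % L = i
  have hsum : ∀ t, walshSum a n F t = ∑ i ∈ Finset.range L, walshSum a n (G i) t := fun t =>
    (Finset.sum_fiberwise_of_maps_to (fun k _ => Finset.mem_range.2 (Nat.mod_lt k hL0)) _).symm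
  have hstepG : ∀ i, Integrable
      (fun t => φ t * Real.exp ((L * x) * walshSum a n (G i) t)) volume := fun i => by
    obtain ⟨J, hJ, hJS⟩ := exists_dyadicStep_walshSum a n (G i) l
    exact ((hφ.mono hJ).mul (hJS.comp fun y => Real.exp ((L * x) * y))).integrable
  have hpt : ∀ t, φ t * Real.exp (x * walshSum a n F t) ≤
      ∑ i ∈ Finset.range L, (1 / (L : ℝ)) *
        (φ t * Real.exp ((L * x) * walshSum a n (G i) t)) := fun t => by
    have h1 := convexOn_exp.map_sum_le (t := Finset.range L) (w := fun _ => 1 / (L : ℝ))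
      (p := fun i => (L * x) * walshSum a n (G i) t) (fun _ _ => by positivity)
      (by simp [hLr.ne']) (fun _ _ => mem_univ _)
    simp only [smul_eq_mul] at h1
    have h2 : ∑ i ∈ Finset.range L, 1 / (L : ℝ) * ((L * x) * walshSum a n (G i) t) =
        x * walshSum a n F t := by
      rw [hsum, Finset.mul_sum]
      refine Finset.sum_congr rfl fun i _ => ?_
      field_simp
    rw [h2] at h1
    refine (mul_le_mul_of_nonneg_left h1 (hφ0 t)).trans_eq ?_
    rw [Finset.mul_sum]
    exact Finset.sum_congr rfl fun i _ => by ring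
  have hint : Integrable (fun t => φ t * Real.exp (x * walshSum a n F t)) volume := by
    obtain ⟨J, hJ, hJS⟩ := exists_dyadicStep_walshSum a n F l
    exact ((hφ.mono hJ).mul (hJS.comp fun y => Real.exp (x * y))).integrable
  calc ∫ t, φ t * Real.exp (x * walshSum a n F t)
      ≤ ∫ t, ∑ i ∈ Finset.range L, (1 / (L : ℝ)) *
        (φ t * Real.exp ((L * x) * walshSum a n (G i) t)) :=
        integral_mono hint (integrable_finsetSum _ fun i _ => (hstepG i).const_mul _) hpt
    _ = ∑ i ∈ Finset.range L, (1 / (L : ℝ)) *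
        ∫ t, φ t * Real.exp ((L * x) * walshSum a n (G i) t) := by
        rw [integral_finsetSum _ fun i _ => (hstepG i).const_mul _]
        exact Finset.sum_congr rfl fun i _ => integral_const_mul _ _
    _ ≤ ∑ i ∈ Finset.range L, (1 / (L : ℝ)) *
        ((∫ t, φ t) * Real.exp (L ^ 2 * (∑ k ∈ F, a k ^ 2) * x ^ 2 / 2)) := by
        refine Finset.sum_le_sum fun i _ => mul_le_mul_of_nonneg_left ?_ (by positivity)
        refine (integral_mul_exp_walshSum_le_of_injOn hφ hφ0 n a (G i) (fun k _ => hn k)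
          ((log_injOn_residueClass hpos hL i).mono fun k hk => ?_) _).trans ?_
        · exact (Finset.mem_filter.1 (Finset.mem_coe.1 hk)).2
        · refine mul_le_mul_of_nonneg_left (Real.exp_le_exp.2 ?_) (integral_nonneg hφ0)
          have : ∑ k ∈ G i, a k ^ 2 ≤ ∑ k ∈ F, a k ^ 2 :=
            Finset.sum_le_sum_of_subset_of_nonneg (Finset.filter_subset _ _)
              fun _ _ _ => sq_nonneg _
          have h2 : (L * x) ^ 2 * ∑ k ∈ G i, a k ^ 2 ≤ (L * x) ^ 2 * ∑ k ∈ F, a k ^ 2 := by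
            gcongr
          linarith
    _ = _ := by
        rw [Finset.sum_const, Finset.card_range, nsmul_eq_mul]
        field_simp

/-- Even moments of a subgaussian step function. -/
theorem integral_mul_pow_le {J : ℕ} {φ S : I → ℝ} (hφ : DyadicStep J φ) (hφ0 : ∀ t, 0 ≤ φ t)
    (hS : DyadicStep J S) {v : ℝ} (hv : 0 < v)
    (h : ∀ x, ∫ t, φ t * Real.exp (x * S t) ≤ (∫ t, φ t) * Real.exp (v * x ^ 2 / 2)) (p : ℕ) :
    ∫ t, φ t * S t ^ (2 * p) ≤ (∫ t, φ t) * (p.factorial * (Real.exp 1 * v) ^ p) := by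
  rcases Nat.eq_zero_or_pos p with rfl | hp
  · simp
  have hpr : (0 : ℝ) < p := by exact_mod_cast hp
  have hI0 : 0 ≤ ∫ t, φ t := integral_nonneg hφ0
  -- This minimizes `exp (v * x ^ 2 / 2) / x ^ (2 * p)`.
  set x := Real.sqrt (2 * p / v) with hx
  have hx2 : x ^ 2 = 2 * p / v := Real.sq_sqrt (by positivity)
  have hx2p : x ^ (2 * p) = (2 * p / v) ^ p := by rw [pow_mul, hx2]
  have hexp : v * x ^ 2 / 2 = p := by rw [hx2]; field_simp
  have hint : ∀ y : ℝ, Integrable (fun t => φ t * Real.exp (y * S t)) volume := fun y =>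
    (hφ.mul (hS.comp fun z => Real.exp (y * z))).integrable
  have hpt : ∀ t, φ t * S t ^ (2 * p) ≤ ((2 * p).factorial / x ^ (2 * p) / 2) *
      (φ t * Real.exp (x * S t) + φ t * Real.exp (-x * S t)) := fun t => by
    have h1 : (x * S t) ^ (2 * p) / (2 * p).factorial ≤ Real.cosh (x * S t) :=
      le_hasSum (Real.hasSum_cosh (x * S t)) p fun j _ => by
        rw [pow_mul]; positivity
    have hxp : 0 < x ^ (2 * p) := by rw [hx2p]; positivity
    rw [Real.cosh_eq, mul_pow, div_le_iff₀ (by positivity)] at h1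
    have h2 : S t ^ (2 * p) ≤ ((2 * p).factorial / x ^ (2 * p) / 2) *
        (Real.exp (x * S t) + Real.exp (-x * S t)) := by
      rw [neg_mul, div_div, div_mul_eq_mul_div, le_div_iff₀ (by positivity)]
      linarith
    calc φ t * S t ^ (2 * p) ≤ φ t * _ := mul_le_mul_of_nonneg_left h2 (hφ0 t)
      _ = _ := by ring
  have hA := h x
  have hB := h (-x)
  rw [neg_sq, hexp] at hB
  rw [hexp] at hA
  -- Keeping one factor `p!` is essential: it cancels the `p!` of the exponential series in the next
  -- lemma.
  have hfac : ((2 * p).factorial : ℝ) ≤ p.factorial * (2 * p) ^ p := by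
    have h1 := Nat.factorial_mul_descFactorial (n := 2 * p) (k := p) (by omega)
    rw [show 2 * p - p = p by omega] at h1
    rw [← h1]
    have h2 := Nat.descFactorial_le_pow (2 * p) p
    exact_mod_cast Nat.mul_le_mul_left _ h2
  calc ∫ t, φ t * S t ^ (2 * p)
      ≤ ∫ t, ((2 * p).factorial / x ^ (2 * p) / 2) *
        (φ t * Real.exp (x * S t) + φ t * Real.exp (-x * S t)) :=
        integral_mono (hφ.mul (hS.comp fun z => z ^ (2 * p))).integrable
          (((hint x).add (hint (-x))).const_mul _) hpt
    _ = ((2 * p).factorial / x ^ (2 * p) / 2) *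
        ((∫ t, φ t * Real.exp (x * S t)) + ∫ t, φ t * Real.exp (-x * S t)) := by
        rw [integral_const_mul, integral_add (hint x) (hint (-x))]
    _ ≤ ((2 * p).factorial / x ^ (2 * p) / 2) *
        ((∫ t, φ t) * Real.exp p + (∫ t, φ t) * Real.exp p) := by
        refine mul_le_mul_of_nonneg_left (add_le_add hA hB) ?_
        rw [hx2p]; positivity
    _ = (∫ t, φ t) * ((2 * p).factorial * (v / (2 * p)) ^ p * Real.exp 1 ^ p) := by
        rw [hx2p, ← Real.exp_nat_mul, mul_one, div_pow, div_pow]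
        field_simp
        ring
    _ ≤ (∫ t, φ t) * (p.factorial * (2 * p) ^ p * (v / (2 * p)) ^ p * Real.exp 1 ^ p) := by
        gcongr
    _ = _ := by
        rw [mul_assoc (p.factorial : ℝ), ← mul_pow, mul_assoc (p.factorial : ℝ), ← mul_pow]
        congr 3
        field_simp

/-- Expand the exponential. The moment bound makes the `p`-th term at most `(∫ φ) * (e * v / c) ^
p`, and the choice of `c` makes this geometric with ratio at most `1 / 3`, with sum `3 / 2`. -/
theorem integral_mul_exp_sq_le {J : ℕ} {φ S : I → ℝ} (hφ : DyadicStep J φ) (hφ0 : ∀ t, 0 ≤ φ t)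
    (hS : DyadicStep J S) {v : ℝ} (hv : 0 < v)
    (h : ∀ x, ∫ t, φ t * Real.exp (x * S t) ≤ (∫ t, φ t) * Real.exp (v * x ^ 2 / 2))
    {c : ℝ} (hc : 3 * Real.exp 1 * v ≤ c) :
    ∫ t, φ t * Real.exp (S t ^ 2 / c) ≤ 3 / 2 * ∫ t, φ t := by
  have he := Real.exp_pos 1
  have hc0 : 0 < c := lt_of_lt_of_le (by positivity) hc
  have hI0 : 0 ≤ ∫ t, φ t := integral_nonneg hφ0
  have hstep : ∀ p : ℕ, DyadicStep J fun t => φ t * ((S t ^ 2 / c) ^ p / p.factorial) := fun p =>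
    hφ.mul (hS.comp fun z => (z ^ 2 / c) ^ p / p.factorial)
  have hF0 : ∀ (p : ℕ) t, 0 ≤ φ t * ((S t ^ 2 / c) ^ p / p.factorial) := fun p t =>
    mul_nonneg (hφ0 t) (by positivity)
  have hbound : ∀ p : ℕ, ∫ t, φ t * ((S t ^ 2 / c) ^ p / p.factorial) ≤
      (∫ t, φ t) * (1 / 3) ^ p := fun p => by
    have h1 := integral_mul_pow_le hφ hφ0 hS hv h p
    calc ∫ t, φ t * ((S t ^ 2 / c) ^ p / p.factorial)
        = ∫ t, (1 / (c ^ p * p.factorial)) * (φ t * S t ^ (2 * p)) := by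
          refine integral_congr_ae (ae_of_all _ fun t => ?_)
          simp only [pow_mul, div_pow]
          field_simp
      _ = (1 / (c ^ p * p.factorial)) * ∫ t, φ t * S t ^ (2 * p) := integral_const_mul _ _
      _ ≤ (1 / (c ^ p * p.factorial)) *
          ((∫ t, φ t) * (p.factorial * (Real.exp 1 * v) ^ p)) := by gcongr
      _ = (∫ t, φ t) * (Real.exp 1 * v / c) ^ p := by rw [div_pow]; field_simp
      _ ≤ _ := by
          refine mul_le_mul_of_nonneg_left (pow_le_pow_left₀ (by positivity) ?_ p) hI0
          rw [div_le_div_iff₀ hc0 (by norm_num)]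
          linarith
  have hgeo : HasSum (fun p : ℕ => (∫ t, φ t) * (1 / 3 : ℝ) ^ p) ((∫ t, φ t) * (1 - 1 / 3)⁻¹) :=
    (hasSum_geometric_of_lt_one (by norm_num) (by norm_num)).mul_left _
  have hnorm : ∀ p : ℕ, ∫ t, ‖φ t * ((S t ^ 2 / c) ^ p / p.factorial)‖ =
      ∫ t, φ t * ((S t ^ 2 / c) ^ p / p.factorial) := fun p =>
    integral_congr_ae (ae_of_all _ fun t => Real.norm_of_nonneg (hF0 p t))
  have hsum := hasSum_integral_of_summable_integral_norm (μ := (volume : Measure I))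
    (F := fun (p : ℕ) t => φ t * ((S t ^ 2 / c) ^ p / p.factorial))
    (fun p => (hstep p).integrable) (by
      simp_rw [hnorm]
      exact Summable.of_nonneg_of_le (fun p => integral_nonneg (hF0 p)) hbound hgeo.summable)
  have hts : ∀ t, ∑' p : ℕ, φ t * ((S t ^ 2 / c) ^ p / p.factorial) =
      φ t * Real.exp (S t ^ 2 / c) := fun t => by
    rw [tsum_mul_left, Real.exp_eq_exp_ℝ, (NormedSpace.expSeries_div_hasSum_exp _).tsum_eq]
  simp_rw [hts] at hsum
  refine (hasSum_le hbound hsum hgeo).trans_eq ?_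
  norm_num
  ring

/-- Orthogonality of distant Walsh functions with respect to a step function. -/
theorem integral_mul_walshSum_sq {l : ℕ} {φ : I → ℝ} (hφ : DyadicStep l φ) {n : ℕ → ℕ}
    (hn : ∀ j k, j ≠ k → 2 ^ l ≤ n j ^^^ n k) (a : ℕ → ℝ) (F : Finset ℕ) :
    ∫ t, φ t * walshSum a n F t ^ 2 = (∫ t, φ t) * ∑ k ∈ F, a k ^ 2 := by
  have h1 : ∀ t, φ t * walshSum a n F t ^ 2 =
      ∑ j ∈ F, ∑ k ∈ F, (a j * a k) * (φ t * walshSign (n j ^^^ n k) t) := fun t => by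
    rw [walshSum, sq, Finset.sum_mul_sum, Finset.mul_sum]
    refine Finset.sum_congr rfl fun j _ => ?_
    rw [Finset.mul_sum]
    refine Finset.sum_congr rfl fun k _ => ?_
    rw [← walshSign_mul]
    ring
  have hint : ∀ m, Integrable (fun t => φ t * walshSign m t) volume := fun m =>
    ((hφ.mono (Nat.le_add_right l m)).mul ((dyadicStep_walshSign Nat.lt_two_pow_self).mono
      (Nat.le_add_left m l))).integrable
  simp_rw [h1]
  rw [integral_finsetSum _ fun j _ => integrable_finsetSum _ fun k _ => (hint _).const_mul _,
    Finset.mul_sum]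
  refine Finset.sum_congr rfl fun j hj => ?_
  rw [integral_finsetSum _ fun k _ => (hint _).const_mul _, Finset.sum_eq_single j]
  · rw [integral_const_mul, Nat.xor_self]
    simp only [walshSign_zero, mul_one]
    ring
  · intro k _ hk
    rw [integral_const_mul, integral_mul_walshSign hφ (hn j k hk.symm), mul_zero]
  · exact fun h => absurd hj h

/-! ### Lacunary sequences -/

theorem IsLacunary.mul_le_succ {q : ℝ} {n : ℕ → ℕ} (h : IsLacunary q n) (k : ℕ) :
    q * n k ≤ n (k + 1) := by
  obtain ⟨h1, h2⟩ := h k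
  rwa [le_div_iff₀ (by exact_mod_cast h1)] at h2

theorem IsLacunary.pow_mul_le {q : ℝ} (hq : 1 < q) {n : ℕ → ℕ} (h : IsLacunary q n) (k m : ℕ) :
    q ^ m * n k ≤ n (k + m) := by
  induction m with
  | zero => simp
  | succ m ih =>
    calc q ^ (m + 1) * n k = q * (q ^ m * n k) := by ring
      _ ≤ q * n (k + m) := by gcongr
      _ ≤ _ := h.mul_le_succ (k + m)

theorem IsLacunary.two_mul_le {q : ℝ} (hq : 1 < q) {n : ℕ → ℕ} (h : IsLacunary q n) {L : ℕ}
    (hL : 2 ≤ q ^ L) (k : ℕ) : 2 * n k ≤ n (k + L) := by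
  have h1 := h.pow_mul_le hq k L
  have h2 : (2 : ℝ) * n k ≤ n (k + L) :=
    (mul_le_mul_of_nonneg_right hL (Nat.cast_nonneg _)).trans h1
  exact_mod_cast h2

theorem IsLacunary.mul_le_of_lt {q : ℝ} (hq : 1 < q) {n : ℕ → ℕ} (h : IsLacunary q n) {j k : ℕ}
    (hjk : j < k) : q * n j ≤ n k := by
  obtain ⟨m, rfl⟩ := Nat.exists_eq_add_of_lt hjk
  have h1 := h.pow_mul_le hq j (m + 1)
  refine le_trans ?_ h1
  gcongr
  exact le_self_pow₀ hq.le (Nat.succ_ne_zero m)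

theorem IsLacunary.strictMono {q : ℝ} (hq : 1 < q) {n : ℕ → ℕ} (h : IsLacunary q n) :
    StrictMono n := fun j k hjk => by
  have h1 := h.mul_le_of_lt hq hjk
  have h2 : (0 : ℝ) < n j := by exact_mod_cast (h j).1
  have h3 : (n j : ℝ) < n k := by nlinarith
  exact_mod_cast h3

theorem IsLacunary.le_xor {q : ℝ} (hq : 1 < q) {n : ℕ → ℕ} (h : IsLacunary q n) {M : ℕ}
    (hM : ∀ k, (M : ℝ) ≤ (q - 1) * n k) {j k : ℕ} (hjk : j ≠ k) : M ≤ n j ^^^ n k := by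
  have key : ∀ j k, j < k → M ≤ n j ^^^ n k := fun j k hjk => by
    have h1 := h.mul_le_of_lt hq hjk
    have h2 : (n k : ℝ) ≤ n j + (n j ^^^ n k : ℕ) := by exact_mod_cast le_add_xor (n j) (n k)
    have h3 := hM j
    have h4 : (M : ℝ) ≤ (n j ^^^ n k : ℕ) := by linarith
    exact_mod_cast h4
  rcases lt_or_gt_of_ne hjk with h1 | h1
  · exact key j k h1
  · rw [Nat.xor_comm]
    exact key k j h1

/-! ### Finite Walsh sums on sets of positive measure -/

/-- Squeeze `E` between a compact `K` and an open `U`. The union `D` of all sufficiently short cells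
meeting `K` stays inside `U`, so the indicators of `D` and `E` differ only on `U \ K`. -/
theorem exists_dyadicStep_approx {E : Set I} (hE : MeasurableSet E) {δ : ℝ} (hδ : 0 < δ) :
    ∃ (l : ℕ) (φ : I → ℝ), DyadicStep l φ ∧ (∀ t, 0 ≤ φ t) ∧
      ∫ t, (E.indicator 1 t - φ t) ^ 2 ≤ δ := by
  have hδ2 : ENNReal.ofReal (δ / 2) ≠ 0 := by simp [hδ]
  obtain ⟨K, hKE, hK, hKlt⟩ := hE.exists_isCompact_lt_add (measure_ne_top volume E) hδ2
  obtain ⟨U, hEU, hU, hUlt⟩ := E.exists_isOpen_lt_add (measure_ne_top volume E) hδ2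
  obtain ⟨r, hr, hrU⟩ := hK.exists_thickening_subset_open hU (hKE.trans hEU)
  obtain ⟨l, hl⟩ := exists_pow_lt_of_lt_one hr (one_half_lt_one (α := ℝ))
  let D : Set I := {t | ∃ s ∈ K, cell l s = cell l t}
  have hKD : K ⊆ D := fun s hs => ⟨s, hs, rfl⟩
  have hDU : D ⊆ U := by
    rintro t ⟨s, hs, hst⟩
    refine hrU (Metric.mem_thickening_iff.2 ⟨s, hs, ?_⟩)
    rw [dist_comm, Subtype.dist_eq, Real.dist_eq]
    refine (abs_sub_lt_of_cell_eq hst).trans ?_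
    rwa [one_div_pow] at hl
  have hstep : DyadicStep l (D.indicator 1) := by
    intro s t hst
    have : s ∈ D ↔ t ∈ D := by
      change (∃ u ∈ K, cell l u = cell l s) ↔ ∃ u ∈ K, cell l u = cell l t
      rw [hst]
    by_cases hs : s ∈ D
    · rw [indicator_of_mem hs, indicator_of_mem (this.1 hs)]; rfl
    · rw [indicator_of_notMem hs, indicator_of_notMem fun h => hs (this.2 h)]
  refine ⟨l, D.indicator 1, hstep, fun t => indicator_nonneg (fun _ _ => zero_le_one) t, ?_⟩
  have hUK : MeasurableSet (U \ K) := hU.measurableSet.diff hK.measurableSet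
  have hpt : ∀ t, (E.indicator (1 : I → ℝ) t - D.indicator 1 t) ^ 2 ≤
      (U \ K).indicator (fun _ => (1 : ℝ)) t := by
    intro t
    by_cases h1 : t ∈ K
    · rw [indicator_of_mem (hKE h1), indicator_of_mem (hKD h1)]
      simp [indicator_nonneg]
    · by_cases h2 : t ∈ U
      · rw [indicator_of_mem (show t ∈ U \ K from ⟨h2, h1⟩)]
        by_cases h3 : t ∈ E <;> by_cases h4 : t ∈ D <;> simp [h3, h4]
      · have h3 : t ∉ E := fun h => h2 (hEU h)
        have h4 : t ∉ D := fun h => h2 (hDU h)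
        simp [h2, h3, h4]
  have hint : Integrable ((U \ K).indicator fun _ => (1 : ℝ)) (volume : Measure I) :=
    (integrable_const 1).indicator hUK
  refine (integral_mono_of_nonneg (ae_of_all _ fun t => sq_nonneg _) hint
    (ae_of_all _ hpt)).trans ?_
  rw [integral_indicator_const _ hUK, smul_eq_mul, mul_one,
    measureReal_sdiff (hKE.trans hEU) hK.measurableSet]
  have e1 : volume.real E ≤ volume.real K + δ / 2 := by
    have := ENNReal.toReal_mono (by finiteness) hKlt.le
    rwa [ENNReal.toReal_add (by finiteness) (by finiteness),
      ENNReal.toReal_ofReal (by positivity)] at this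
  have e2 : volume.real U ≤ volume.real E + δ / 2 := by
    have := ENNReal.toReal_mono (by finiteness) hUlt.le
    rwa [ENNReal.toReal_add (by finiteness) (by finiteness),
      ENNReal.toReal_ofReal (by positivity)] at this
  linarith

/-- Cauchy–Schwarz in the form of Young's inequality, with the weight `θ` left free to balance the
two error terms. -/
theorem abs_setIntegral_sub_le {E : Set I} (hE : MeasurableSet E) {J : ℕ} {φ h : I → ℝ}
    (hφ : DyadicStep J φ) (hh : DyadicStep J h) {δ θ : ℝ} (hθ : 0 < θ)
    (hδ : ∫ t, (E.indicator 1 t - φ t) ^ 2 ≤ δ) :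
    |(∫ t in E, h t) - ∫ t, φ t * h t| ≤ θ / 2 * (∫ t, h t ^ 2) + δ / (2 * θ) := by
  have hEi : Integrable (fun t => (E.indicator 1 t - φ t) ^ 2) (volume : Measure I) := by
    obtain ⟨C, hC⟩ := hφ.exists_bound
    refine Integrable.of_bound ((((measurable_const.indicator hE).sub
      hφ.measurable).pow_const 2).aestronglyMeasurable) ((1 + C) ^ 2) (ae_of_all _ fun t => ?_)
    rw [Real.norm_eq_abs, abs_pow]
    refine pow_le_pow_left₀ (abs_nonneg _) ((abs_sub _ _).trans (add_le_add ?_ (hC t))) 2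
    by_cases h : t ∈ E <;> simp [h]
  have hhi : Integrable (fun t => h t ^ 2) (volume : Measure I) :=
    (hh.comp fun z => z ^ 2).integrable
  have h1 : (∫ t in E, h t) - ∫ t, φ t * h t = ∫ t, (E.indicator 1 t - φ t) * h t := by
    rw [← integral_indicator hE, ← integral_sub (hh.integrable.indicator hE)
      (hφ.mul hh).integrable]
    refine integral_congr_ae (ae_of_all _ fun t => ?_)
    by_cases h : t ∈ E <;> simp [h]
    ring
  rw [h1]
  refine (abs_integral_le_integral_abs).trans ?_
  have h2 : ∀ t, |(E.indicator 1 t - φ t) * h t| ≤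
      θ / 2 * h t ^ 2 + 1 / (2 * θ) * (E.indicator 1 t - φ t) ^ 2 := fun t => by
    set u := E.indicator 1 t - φ t
    have h3 : 0 ≤ (θ * |h t| - |u|) ^ 2 := sq_nonneg _
    rw [abs_mul, ← sq_abs (h t), ← sq_abs u, div_mul_eq_mul_div, div_mul_eq_mul_div,
      div_add_div _ _ two_ne_zero (by positivity), le_div_iff₀ (by positivity)]
    nlinarith
  refine (integral_mono_of_nonneg (ae_of_all _ fun t => abs_nonneg _)
    ((hhi.const_mul _).add (hEi.const_mul _)) (ae_of_all _ h2)).trans ?_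
  rw [integral_add' (hhi.const_mul _) (hEi.const_mul _), integral_const_mul, integral_const_mul]
  have h4 : 1 / (2 * θ) * (∫ t, (E.indicator 1 t - φ t) ^ 2) ≤ 1 / (2 * θ) * δ := by gcongr
  rw [one_div_mul_eq_div _ δ] at h4
  linarith

/-- The variance factor of sums of `L` sequences of independent signs. -/
def varianceFactor (L : ℕ) : ℝ := Real.exp 1 * L ^ 2

theorem one_le_varianceFactor {L : ℕ} (hL : 0 < L) : 1 ≤ varianceFactor L := by
  have h1 : (1 : ℝ) ≤ L := by exact_mod_cast hL
  exact one_le_mul_of_one_le_of_one_le (Real.one_le_exp zero_le_one) (one_le_pow₀ h1)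

/-- The index from which on the Walsh functions behave on `E` as on the whole interval. -/
theorem exists_local_bounds_of_measurableSet {q : ℝ} (hq : 1 < q) {L : ℕ} (hL0 : 0 < L) (hL : 2 ≤ q ^ L)
    {E : Set I} (hE : MeasurableSet E) (hE0 : 0 < volume.real E) :
    ∃ N : ℕ, ∀ n : ℕ → ℕ, IsLacunary q n → (∀ k, N ≤ n k) → ∀ (a : ℕ → ℝ) (F : Finset ℕ),
      (∀ V, 0 < V → ∑ k ∈ F, a k ^ 2 ≤ V →
        ∫ t in E, (Real.exp (walshSum a n F t ^ 2 / (6 * varianceFactor L * V)) - 1) ≤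
          volume.real E) ∧
      volume.real E * (∑ k ∈ F, a k ^ 2) / 2 ≤ ∫ t in E, walshSum a n F t ^ 2 := by
  set κ := varianceFactor L
  have hκ : 1 ≤ κ := one_le_varianceFactor hL0
  set m := volume.real E
  -- Small enough for three comparisons: the mass of `φ`, the exponential bound and the second
  -- moment, the last of which determines the factor `κ ^ 2`.
  set δ := m ^ 2 / (32 * κ ^ 2) with hδ
  have hδ0 : 0 < δ := by positivity
  obtain ⟨l, φ, hφ, hφ0, hφδ⟩ := exists_dyadicStep_approx hE hδ0
  have hq1 : 0 < q - 1 := by linarith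
  obtain ⟨N₁, hN₁⟩ := exists_nat_ge ((2 : ℝ) ^ l / (q - 1))
  have hδm : δ ≤ m ^ 2 / 32 := by
    rw [hδ]
    gcongr
    nlinarith
  have hφm : |m - ∫ t, φ t| ≤ 3 * m / 16 := by
    have h1 := abs_setIntegral_sub_le hE hφ (DyadicStep.const (j := l) 1)
      (show 0 < m / 4 by positivity) hφδ
    have h2 : δ / (2 * (m / 4)) ≤ m / 16 := by
      rw [div_le_iff₀ (by positivity)]
      linarith
    simp only [integral_const, measureReal_restrict_apply_univ, smul_eq_mul, mul_one, one_pow,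
      probReal_univ] at h1
    linarith
  obtain ⟨hφm1, hφm2⟩ := abs_le.1 hφm
  -- The first entry gives independence from `φ`; the second makes `(q - 1) * n k ≥ 2 ^ l`, so that
  -- products of two distinct terms are orthogonal to `φ`.
  refine ⟨max (2 ^ l) N₁, fun n hn hN a F => ?_⟩
  have hnl : ∀ k, 2 ^ l ≤ n k := fun k => (le_max_left _ _).trans (hN k)
  have hxor : ∀ j k, j ≠ k → 2 ^ l ≤ n j ^^^ n k := fun j k hjk => by
    refine hn.le_xor hq (fun k => ?_) hjk
    push_cast
    rw [div_le_iff₀ hq1] at hN₁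
    have h1 : (N₁ : ℝ) ≤ n k := by exact_mod_cast (le_max_right _ _).trans (hN k)
    nlinarith
  obtain ⟨J, hlJ, hS⟩ := exists_dyadicStep_walshSum a n F l
  have hone : ∀ x V, ∑ k ∈ F, a k ^ 2 ≤ V → ∫ t, 1 * Real.exp (x * walshSum a n F t) ≤
      (∫ _ : I, (1 : ℝ)) * Real.exp (L ^ 2 * V * x ^ 2 / 2) := fun x V hV => by
    refine (integral_mul_exp_walshSum_le hL0 (DyadicStep.const (j := 0) 1) (fun _ => zero_le_one)
      (hn.two_mul_le hq hL) (fun k => (hn k).1) a F x).trans ?_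
    gcongr
  have hφexp : ∀ x V, ∑ k ∈ F, a k ^ 2 ≤ V → ∫ t, φ t * Real.exp (x * walshSum a n F t) ≤
      (∫ t, φ t) * Real.exp (L ^ 2 * V * x ^ 2 / 2) := fun x V hV => by
    refine (integral_mul_exp_walshSum_le hL0 hφ hφ0 (hn.two_mul_le hq hL) hnl a F x).trans ?_
    gcongr
    exact integral_nonneg hφ0
  have hLr : (0 : ℝ) < L := by exact_mod_cast hL0
  set S := walshSum a n F
  constructor
  · intro V hV hVa
    have hc : 0 < 6 * κ * V := by positivity
    set c := 6 * κ * V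
    have h1 : ∫ t, φ t * Real.exp (S t ^ 2 / c) ≤ 3 / 2 * ∫ t, φ t :=
      integral_mul_exp_sq_le (hφ.mono hlJ) hφ0 hS (show 0 < L ^ 2 * V by positivity)
        (fun x => hφexp x V hVa) (by
          change _ ≤ 6 * (Real.exp 1 * L ^ 2) * V
          have : 0 < Real.exp 1 * L ^ 2 * V := by positivity
          linarith)
    -- The error term needs the square of `exp y - 1`, which is at most `exp (2 * y) - 1` for `y ≥
    -- 0`. The doubled exponent explains the constant `6` in place of `3`.
    have h2 : ∫ t, 1 * Real.exp (S t ^ 2 / (c / 2)) ≤ 3 / 2 * ∫ _ : I, (1 : ℝ) :=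
      integral_mul_exp_sq_le (DyadicStep.const 1) (fun _ => zero_le_one) hS
        (show 0 < L ^ 2 * V by positivity) (fun x => hone x V hVa) (by
          change _ ≤ 6 * (Real.exp 1 * L ^ 2) * V / 2
          linarith)
    have hexp : DyadicStep J fun t => Real.exp (S t ^ 2 / c) :=
      hS.comp fun z => Real.exp (z ^ 2 / c)
    have hexp2 : DyadicStep J fun t => Real.exp (S t ^ 2 / (c / 2)) :=
      hS.comp fun z => Real.exp (z ^ 2 / (c / 2))
    have hh : DyadicStep J fun t => Real.exp (S t ^ 2 / c) - 1 :=
      hS.comp fun z => Real.exp (z ^ 2 / c) - 1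
    have h3 := abs_setIntegral_sub_le hE (hφ.mono hlJ) hh hE0 hφδ
    have h4 : ∫ t, φ t * (Real.exp (S t ^ 2 / c) - 1) ≤ 1 / 2 * ∫ t, φ t := by
      simp_rw [mul_sub, mul_one]
      rw [integral_sub ((hφ.mono hlJ).mul hexp).integrable hφ.integrable]
      linarith
    have h5 : ∫ t, (Real.exp (S t ^ 2 / c) - 1) ^ 2 ≤ 1 / 2 := by
      calc ∫ t, (Real.exp (S t ^ 2 / c) - 1) ^ 2
          ≤ ∫ t, (Real.exp (S t ^ 2 / (c / 2)) - 1) := by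
            refine integral_mono (hh.comp fun z => z ^ 2).integrable
              (hexp2.integrable.sub (integrable_const 1)) fun t => ?_
            have e1 : S t ^ 2 / (c / 2) = S t ^ 2 / c + S t ^ 2 / c := by field_simp; ring
            have e2 : 1 ≤ Real.exp (S t ^ 2 / c) := Real.one_le_exp (by positivity)
            simp only [e1, Real.exp_add]
            nlinarith
        _ ≤ 1 / 2 := by
            rw [integral_sub hexp2.integrable (integrable_const 1)]
            simp only [one_mul, integral_const, smul_eq_mul, probReal_univ] at h2 ⊢
            linarith
    have h6 : δ / (2 * m) ≤ m / 64 := by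
      rw [div_le_iff₀ (by positivity)]
      linarith
    have h7 := (abs_le.1 h3).2
    have h8 : m / 2 * ∫ t, (Real.exp (S t ^ 2 / c) - 1) ^ 2 ≤ m / 2 * (1 / 2) := by gcongr
    linarith
  · rcases (Finset.sum_nonneg fun k _ => sq_nonneg (a k) :
      0 ≤ ∑ k ∈ F, a k ^ 2).eq_or_lt with h0 | hv
    · rw [← h0, mul_zero, zero_div]
      exact integral_nonneg fun _ => sq_nonneg _
    set v := ∑ k ∈ F, a k ^ 2
    have h1 : ∫ t, 1 * S t ^ (2 * 2) ≤ (∫ _ : I, (1 : ℝ)) *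
        ((Nat.factorial 2) * (Real.exp 1 * (L ^ 2 * v)) ^ 2) :=
      integral_mul_pow_le (DyadicStep.const 1) (fun _ => zero_le_one) hS (by positivity)
        (fun x => hone x v le_rfl) 2
    rw [← mul_assoc (Real.exp 1)] at h1
    change _ ≤ _ * ((Nat.factorial 2) * (κ * v) ^ 2) at h1
    simp only [one_mul, integral_const, smul_eq_mul, probReal_univ, pow_mul,
      Nat.factorial_two, Nat.cast_ofNat] at h1
    have h2 : ∫ t, φ t * S t ^ 2 = (∫ t, φ t) * v := integral_mul_walshSum_sq hφ hxor a F
    -- This `θ` bounds both errors by `m * v / 8`. The main term is at least `13 / 16 * m * v`, so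
    -- more than half of `m * v` survives.
    have h3 := abs_setIntegral_sub_le hE (hφ.mono hlJ) (hS.comp fun z => z ^ 2)
      (show 0 < m / (8 * κ ^ 2 * v) by positivity) hφδ
    have h4 : m / (8 * κ ^ 2 * v) / 2 * ∫ t, (S t ^ 2) ^ 2 ≤ m * v / 8 := by
      calc m / (8 * κ ^ 2 * v) / 2 * ∫ t, (S t ^ 2) ^ 2
          ≤ m / (8 * κ ^ 2 * v) / 2 * (2 * (κ * v) ^ 2) := by gcongr
        _ = _ := by field_simp
    have h5 : δ / (2 * (m / (8 * κ ^ 2 * v))) = m * v / 8 := by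
      rw [hδ]
      field_simp
      norm_num
    have h6 := (abs_le.1 h3).1
    nlinarith

theorem exists_local_bounds {q : ℝ} (hq : 1 < q) {L : ℕ} (hL0 : 0 < L) (hL : 2 ≤ q ^ L)
    {E : Set I} (hE : NullMeasurableSet E volume) (hE0 : 0 < volume.real E) :
    ∃ N : ℕ, ∀ n : ℕ → ℕ, IsLacunary q n → (∀ k, N ≤ n k) → ∀ (a : ℕ → ℝ) (F : Finset ℕ),
      (∀ V, 0 < V → ∑ k ∈ F, a k ^ 2 ≤ V →
        ∫ t in E, (Real.exp (walshSum a n F t ^ 2 / (6 * varianceFactor L * V)) - 1) ≤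
          volume.real E) ∧
      volume.real E * (∑ k ∈ F, a k ^ 2) / 2 ≤ ∫ t in E, walshSum a n F t ^ 2 := by
  obtain ⟨E', _, hE', hEE'⟩ := hE.exists_measurable_superset_ae_eq
  rw [← measureReal_congr hEE'] at hE0
  have h := exists_local_bounds_of_measurableSet hq hL0 hL hE' hE0
  rwa [measureReal_congr hEE', Measure.restrict_congr_set hEE'] at h

/-- A Paley–Zygmund type bound. -/
theorem le_measureReal_lt_sq {E : Set I} {J : ℕ} {S : I → ℝ}
    (hS : DyadicStep J S) {κ v : ℝ} (hκ : 0 < κ) (hv : 0 < v)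
    (h2 : volume.real E * v / 2 ≤ ∫ t in E, S t ^ 2)
    (hexp : ∫ t in E, (Real.exp (S t ^ 2 / (6 * κ * v)) - 1) ≤ volume.real E) :
    volume.real E / (1152 * κ ^ 2) ≤ volume.real (E ∩ {t | v / 4 < S t ^ 2}) := by
  set m := volume.real E
  have hAm : MeasurableSet {t | v / 4 < S t ^ 2} :=
    measurableSet_lt measurable_const (hS.measurable.pow_const 2)
  set A := {t | v / 4 < S t ^ 2}
  have hSi : ∀ p : ℕ, Integrable (fun t => S t ^ p) (volume.restrict E) := fun p =>
    (hS.comp fun z => z ^ p).integrable.restrict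
  -- From `y ^ 2 / 2 ≤ exp y - 1` with `y = S t ^ 2 / (6 * κ * v)`.
  have h4 : ∫ t in E, S t ^ 4 ≤ 72 * κ ^ 2 * v ^ 2 * m := by
    calc ∫ t in E, S t ^ 4
        ≤ ∫ t in E, 72 * κ ^ 2 * v ^ 2 * (Real.exp (S t ^ 2 / (6 * κ * v)) - 1) := by
          refine integral_mono (hSi 4)
            (hS.comp fun z => 72 * κ ^ 2 * v ^ 2 *
              (Real.exp (z ^ 2 / (6 * κ * v)) - 1)).integrable.restrict fun t => ?_
          have h := Real.quadratic_le_exp_of_nonneg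
            (show 0 ≤ S t ^ 2 / (6 * κ * v) by positivity)
          have h0 : 0 ≤ S t ^ 2 / (6 * κ * v) := by positivity
          have h1 : S t ^ 4 = 72 * κ ^ 2 * v ^ 2 * ((S t ^ 2 / (6 * κ * v)) ^ 2 / 2) := by
            field_simp
            ring
          simp only [h1]
          gcongr
          linarith
      _ ≤ _ := by
          rw [integral_const_mul]
          gcongr
  -- On `A` this is a completed square. The coefficient of `S t ^ 4` is tuned so that the fourth
  -- moment contributes at most `m * v / 8`; with `m * v / 4` from outside `A`, an eighth of `m * v`
  -- remains for the measure of `A`.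
  have hpt : ∀ t, S t ^ 2 ≤ v / 4 + (1 / (576 * κ ^ 2 * v)) * S t ^ 4 +
      144 * κ ^ 2 * v * A.indicator 1 t := fun t => by
    have hp : 0 ≤ (1 / (576 * κ ^ 2 * v)) * S t ^ 4 := by positivity
    by_cases h : t ∈ A
    · rw [indicator_of_mem h, Pi.one_apply, mul_one]
      have h1 : 0 ≤ (1 / (576 * κ ^ 2 * v)) * (S t ^ 2 - 288 * κ ^ 2 * v) ^ 2 := by positivity
      have h3 : (1 / (576 * κ ^ 2 * v)) * (S t ^ 2 - 288 * κ ^ 2 * v) ^ 2 =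
          (1 / (576 * κ ^ 2 * v)) * S t ^ 4 - S t ^ 2 + 144 * κ ^ 2 * v := by
        field_simp
        ring
      linarith
    · rw [indicator_of_notMem h, mul_zero]
      have h1 : S t ^ 2 ≤ v / 4 := not_lt.1 h
      linarith
  have hAi : Integrable (A.indicator (1 : I → ℝ)) (volume.restrict E) :=
    (integrable_const 1).indicator hAm
  have hvi : Integrable (fun t => v / 4 + (1 / (576 * κ ^ 2 * v)) * S t ^ 4)
      (volume.restrict E) := (integrable_const _).add ((hSi 4).const_mul _)
  have h5 : ∫ t in E, S t ^ 2 ≤ ∫ t in E, (v / 4 + (1 / (576 * κ ^ 2 * v)) * S t ^ 4 +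
      144 * κ ^ 2 * v * A.indicator 1 t) :=
    integral_mono (hSi 2) (hvi.add (hAi.const_mul _)) hpt
  rw [integral_add hvi (hAi.const_mul _),
    integral_add (integrable_const _) ((hSi 4).const_mul _), integral_const_mul,
    integral_const_mul, integral_indicator_one hAm, measureReal_restrict_apply hAm,
    integral_const, measureReal_restrict_apply_univ, smul_eq_mul, inter_comm A E] at h5
  have h6 : 1 / (576 * κ ^ 2 * v) * ∫ t in E, S t ^ 4 ≤ m * v / 8 := by
    calc 1 / (576 * κ ^ 2 * v) * ∫ t in E, S t ^ 4
        ≤ 1 / (576 * κ ^ 2 * v) * (72 * κ ^ 2 * v ^ 2 * m) := by gcongr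
      _ = _ := by field_simp; ring
  have h7 : m * v / 8 ≤ 144 * κ ^ 2 * v * volume.real (E ∩ A) := by
    change _ ≤ m * (v / 4) + _ + _ at h5
    linarith
  rw [div_le_iff₀ (by positivity)]
  have h8 : v * m ≤ v * (volume.real (E ∩ A) * (1152 * κ ^ 2)) := by linarith
  exact le_of_mul_le_mul_left h8 hv

/-! ### The space `G` -/

theorem exp_mul_sub_one_le {x y : ℝ} (hx0 : 0 ≤ x) (hx1 : x ≤ 1) :
    Real.exp (x * y) - 1 ≤ x * (Real.exp y - 1) := by
  have h := convexOn_exp.2 (mem_univ y) (mem_univ 0) hx0 (sub_nonneg.2 hx1) (by ring)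
  simp only [smul_eq_mul, mul_zero, add_zero, Real.exp_zero, mul_one] at h
  linarith

theorem M2_nonneg (x : ℝ) : 0 ≤ M2 x :=
  sub_nonneg.2 (Real.one_le_exp (sq_nonneg x))

theorem continuous_M2 : Continuous M2 := by
  unfold M2
  fun_prop

theorem M2_abs_div (x c : ℝ) : M2 (|x| / c) = Real.exp (x ^ 2 / c ^ 2) - 1 := by
  rw [M2, div_pow, sq_abs]

theorem M2_abs_div_le (x : ℝ) {c : ℝ} (hc : 1 ≤ c) : M2 (|x| / c) ≤ 1 / c ^ 2 * M2 |x| := by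
  have hc0 : 0 < c := by linarith
  rw [M2_abs_div, M2, sq_abs, div_eq_inv_mul, ← one_div]
  exact exp_mul_sub_one_le (by positivity) (by
    rw [div_le_one (by positivity)]
    exact one_le_pow₀ hc)

theorem orliczNorm_le {Φ : ℝ → ℝ} {f : L0} {c : ℝ} (hc : 0 < c)
    (h : ∫⁻ t : I, ENNReal.ofReal (Φ (|f t| / c)) ≤ 1) : orliczNorm Φ f ≤ ENNReal.ofReal c :=
  iInf₂_le c ⟨hc, h⟩

/-- All exponential moments of `f²` are finite. -/
def AllSqExpMoments (f : L0) : Prop :=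
  ∀ x : ℝ, 0 < x → ∫⁻ t : I, ENNReal.ofReal (Real.exp (x * f t ^ 2)) < ∞

theorem AllSqExpMoments.of_sq_le {f g : L0} (hf : AllSqExpMoments f)
    {c : ℝ} (h : ∀ᵐ t, g t ^ 2 ≤ c ^ 2 * f t ^ 2) : AllSqExpMoments g := fun x hx => by
  refine lt_of_le_of_lt (lintegral_mono_ae ?_) (hf (x * (c ^ 2 + 1)) (by positivity))
  filter_upwards [h] with t ht
  refine ENNReal.ofReal_le_ofReal (Real.exp_le_exp.2 ?_)
  nlinarith [sq_nonneg (f t), mul_le_mul_of_nonneg_left ht hx.le,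
    mul_nonneg hx.le (sq_nonneg (f t))]

theorem allSqExpMoments_of_bound {f : L0} {R : ℝ} (h : ∀ᵐ t, |f t| ≤ R) :
    AllSqExpMoments f := fun x hx => by
  refine lt_of_le_of_lt (lintegral_mono_ae (g := fun _ => ENNReal.ofReal (Real.exp (x * R ^ 2)))
    ?_) (by simp)
  filter_upwards [h] with t ht
  refine ENNReal.ofReal_le_ofReal (Real.exp_le_exp.2 (mul_le_mul_of_nonneg_left ?_ hx.le))
  exact sq_le_sq.2 (ht.trans (le_abs_self R))

/-- If `|g| ≤ R` then `f ^ 2 ≤ 2 * R ^ 2 + 2 * (f - g) ^ 2`, so closeness at scale `c = 1 / √(2 *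
x)` controls the moment of order `x`. -/
theorem allSqExpMoments_of_approx {f : L0}
    (h : ∀ c : ℝ, 0 < c → ∃ (g : L0) (R : ℝ), (∀ᵐ t, |g t| ≤ R) ∧
      ∫⁻ t : I, ENNReal.ofReal (M2 (|(f - g : L0) t| / c)) ≤ 1) : AllSqExpMoments f := by
  intro x hx
  have hc2 : (1 / Real.sqrt (2 * x)) ^ 2 = 1 / (2 * x) := by
    rw [div_pow, Real.sq_sqrt (by positivity), one_pow]
  obtain ⟨g, R, hg, hfg⟩ := h (1 / Real.sqrt (2 * x)) (by positivity)
  have hpt : ∀ᵐ t : I, ENNReal.ofReal (Real.exp (x * f t ^ 2)) ≤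
      ENNReal.ofReal (Real.exp (2 * x * R ^ 2)) *
        (ENNReal.ofReal (M2 (|(f - g : L0) t| / (1 / Real.sqrt (2 * x)))) + 1) := by
    filter_upwards [hg, AEEqFun.coeFn_sub f g] with t h1 h2
    rw [← ENNReal.ofReal_one, ← ENNReal.ofReal_add (M2_nonneg _) zero_le_one,
      ← ENNReal.ofReal_mul (Real.exp_pos _).le]
    refine ENNReal.ofReal_le_ofReal ?_
    rw [M2_abs_div, hc2, sub_add_cancel, ← Real.exp_add, h2, Pi.sub_apply, Real.exp_le_exp,
      div_div_eq_mul_div, div_one]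
    have h3 : g t ^ 2 ≤ R ^ 2 := sq_le_sq.2 (h1.trans (le_abs_self R))
    have h4 : f t ^ 2 ≤ 2 * R ^ 2 + 2 * (f t - g t) ^ 2 := by
      nlinarith [sq_nonneg (f t - 2 * g t)]
    nlinarith [mul_le_mul_of_nonneg_left h4 hx.le]
  refine lt_of_le_of_lt (lintegral_mono_ae hpt) ?_
  rw [lintegral_const_mul' _ _ ENNReal.ofReal_ne_top, lintegral_add_right _ measurable_const]
  refine ENNReal.mul_lt_top ENNReal.ofReal_lt_top (ENNReal.add_lt_top.2
    ⟨hfg.trans_lt ENNReal.one_lt_top, by simp⟩)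

theorem allSqExpMoments_of_mem_spaceG {f : L0} (hf : f ∈ spaceG) : AllSqExpMoments f := by
  refine allSqExpMoments_of_approx fun c hc => ?_
  obtain ⟨g, hg, hfg⟩ := hf.2 (ENNReal.ofReal (c / 2)) (by simpa using hc)
  have hlt : orliczNorm M2 (f - g) < ENNReal.ofReal c :=
    hfg.trans_lt ((ENNReal.ofReal_lt_ofReal_iff hc).2 (by linarith))
  obtain ⟨d, hd⟩ := iInf_lt_iff.1 hlt
  obtain ⟨⟨hd0, hd1⟩, hdc⟩ := iInf_lt_iff.1 hd
  have hdc' : d < c := (ENNReal.ofReal_lt_ofReal_iff hc).1 hdc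
  refine ⟨g, (eLpNormEssSup g volume).toReal, ?_, le_trans (lintegral_mono fun t => ?_) hd1⟩
  · have hgt : eLpNormEssSup g (volume : Measure I) ≠ ∞ := by
      have := (Lp.mem_Lp_iff_memLp.1 hg).2
      rw [eLpNorm_exponent_top] at this
      exact this.ne
    filter_upwards [ae_le_eLpNormEssSup (f := g) (μ := (volume : Measure I))] with t ht
    rw [← Real.norm_eq_abs, ← toReal_enorm]
    exact ENNReal.toReal_mono hgt ht
  · refine ENNReal.ofReal_le_ofReal ?_
    rw [M2_abs_div, M2_abs_div]
    gcongr

/-- Truncations of `f` converge to it at every scale `c` by dominated convergence. With the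
preceding lemma this characterizes `G` by exponential moments, the form used from here on. -/
theorem AllSqExpMoments.mem_spaceG {f : L0} (hf : AllSqExpMoments f) : f ∈ spaceG := by
  have hfm : Measurable (f : I → ℝ) := f.measurable
  constructor
  · have hfin : ∫⁻ t : I, ENNReal.ofReal (M2 |f t|) < ∞ := by
      refine lt_of_le_of_lt (lintegral_mono fun t => ENNReal.ofReal_le_ofReal ?_)
        (hf 1 one_pos)
      rw [M2, sq_abs, one_mul]
      linarith
    set K := (∫⁻ t : I, ENNReal.ofReal (M2 |f t|)).toReal
    have hK0 : 0 ≤ K := ENNReal.toReal_nonneg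
    have hc1 : 1 ≤ 1 + K := by linarith
    refine lt_of_le_of_lt (orliczNorm_le (c := 1 + K) (by linarith) ?_) ENNReal.ofReal_lt_top
    calc ∫⁻ t : I, ENNReal.ofReal (M2 (|f t| / (1 + K)))
        ≤ ∫⁻ t : I, ENNReal.ofReal (1 / (1 + K) ^ 2) * ENNReal.ofReal (M2 |f t|) := by
          refine lintegral_mono fun t => ?_
          simp only [← ENNReal.ofReal_mul (show 0 ≤ 1 / (1 + K) ^ 2 by positivity)]
          exact ENNReal.ofReal_le_ofReal (M2_abs_div_le _ hc1)
      _ = ENNReal.ofReal (1 / (1 + K) ^ 2 * K) := by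
          rw [lintegral_const_mul' _ _ ENNReal.ofReal_ne_top,
            ENNReal.ofReal_mul (by positivity), ENNReal.ofReal_toReal hfin.ne]
      _ ≤ 1 := by
          rw [ENNReal.ofReal_le_one, one_div_mul_eq_div, div_le_one (by positivity)]
          nlinarith
  · intro ε hε
    obtain ⟨c, hc, hcε⟩ : ∃ c : ℝ, 0 < c ∧ ENNReal.ofReal c ≤ ε := by
      rcases eq_or_ne ε ∞ with rfl | h
      · exact ⟨1, one_pos, le_top⟩
      · exact ⟨ε.toReal, ENNReal.toReal_pos hε.ne' h, ENNReal.ofReal_toReal_le⟩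
    let A : ℕ → Set I := fun R => {t | |f t| ≤ R}
    have hA : ∀ R, MeasurableSet (A R) := fun R =>
      measurableSet_le hfm.abs measurable_const
    have hlim : Tendsto (fun R : ℕ => ∫⁻ t : I,
        ENNReal.ofReal (M2 (|f t - (A R).indicator f t| / c))) atTop (𝓝 (∫⁻ _ : I, 0)) := by
      refine tendsto_lintegral_of_dominated_convergence
        (fun t => ENNReal.ofReal (Real.exp (1 / c ^ 2 * f t ^ 2))) (fun R => ?_) (fun R => ?_)
        (hf _ (by positivity)).ne ?_
      · exact ENNReal.measurable_ofReal.comp (continuous_M2.measurable.comp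
          ((hfm.sub (hfm.indicator (hA R))).abs.div_const c))
      · refine ae_of_all _ fun t => ENNReal.ofReal_le_ofReal ?_
        rw [M2_abs_div, one_div_mul_eq_div]
        have h1 : (f t - (A R).indicator f t) ^ 2 ≤ f t ^ 2 := by
          by_cases h : t ∈ A R <;> simp [h, sq_nonneg]
        have h2 : Real.exp ((f t - (A R).indicator f t) ^ 2 / c ^ 2) ≤
            Real.exp (f t ^ 2 / c ^ 2) := by gcongr
        linarith
      · refine ae_of_all _ fun t => tendsto_const_nhds.congr' ?_
        obtain ⟨R₀, hR₀⟩ := exists_nat_ge |f t|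
        filter_upwards [eventually_ge_atTop R₀] with R hR
        have h : t ∈ A R := hR₀.trans (by exact_mod_cast hR)
        simp [h, M2]
    rw [lintegral_zero] at hlim
    obtain ⟨R, hR⟩ := (hlim.eventually_le_const (zero_lt_one (α := ℝ≥0∞))).exists
    have hgm : AEStronglyMeasurable ((A R).indicator f) (volume : Measure I) :=
      (hfm.indicator (hA R)).aestronglyMeasurable
    refine ⟨AEEqFun.mk _ hgm, ?_,
      (orliczNorm_le hc (le_trans (lintegral_mono_ae ?_) hR)).trans hcε⟩
    · rw [Lp.mem_Lp_iff_memLp]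
      refine memLp_top_of_bound (AEEqFun.aestronglyMeasurable _) R ?_
      filter_upwards [AEEqFun.coeFn_mk _ hgm] with t ht
      rw [ht]
      by_cases h : t ∈ A R
      · rw [indicator_of_mem h]
        exact h
      · simp [h]
    · filter_upwards [AEEqFun.coeFn_mk _ hgm, AEEqFun.coeFn_sub f (AEEqFun.mk _ hgm)] with t h1 h2
      rw [h2, Pi.sub_apply, h1]

/-! ### Two properties of the norm of an r.i. space -/

namespace BanachFunctionSpace

variable (X : BanachFunctionSpace)

/-- `G ⊆ X` is a bounded embedding. -/
theorem exists_extNorm_le_of_spaceG_subset (hX : spaceG ⊆ (X.carrier : Set L0)) :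
    ∃ K : ℝ, 0 < K ∧ ∀ g ∈ spaceG, ∫⁻ t : I, ENNReal.ofReal (M2 |g t|) ≤ 1 →
      X.extNorm g ≤ ENNReal.ofReal K := by
  by_contra! hcon
  -- If the embedding were unbounded, some `g k` in the unit ball of `G` would have norm above `4 ^
  -- k`. The supremum of the `|g k| / 2 ^ k` is shown to lie in `G`, hence in `X`, although its norm
  -- must exceed every `2 ^ k`.
  choose g hgG hg1 hgK using fun k : ℕ => hcon (4 ^ k) (by positivity)
  have hgm : ∀ k, Measurable (g k : I → ℝ) := fun k => (g k).measurable
  let h : I → ℝ := fun t => ⨆ k, |g k t| / 2 ^ k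
  have hm : Measurable h := Measurable.iSup fun k => (hgm k).abs.div_const _
  have hh0 : ∀ t, 0 ≤ h t := fun t => Real.iSup_nonneg fun k => by positivity
  let u : ℝ → ℕ → I → ℝ≥0∞ := fun x k t =>
    ENNReal.ofReal (Real.exp (x * (|g k t| / 2 ^ k) ^ 2) - 1)
  have hum : ∀ x k, Measurable (u x k) := fun x k => by
    have := hgm k
    fun_prop
  have hsum : ∀ x, 0 < x → ∫⁻ t, ∑' k, u x k t ≠ ∞ := by
    intro x hx
    rw [lintegral_tsum fun k => (hum x k).aemeasurable]
    have hfin : ∀ k, ∫⁻ t, u x k t ≠ ∞ := fun k => by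
      refine ne_top_of_le_ne_top
        (allSqExpMoments_of_mem_spaceG (hgG k) (x / 4 ^ k) (by positivity)).ne
        (lintegral_mono fun t => ENNReal.ofReal_le_ofReal ?_)
      have h4 : ((2 : ℝ) ^ k) ^ 2 = 4 ^ k := by rw [← pow_mul, mul_comm, pow_mul]; norm_num
      have e : x * (|g k t| / 2 ^ k) ^ 2 = x / 4 ^ k * g k t ^ 2 := by
        rw [div_pow, sq_abs, h4]
        ring
      rw [e]
      linarith
    -- Once `4 ^ k ≥ x`, convexity bounds the `k`-th integral by `x / 4 ^ k`. The finitely many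
    -- earlier ones are finite because each `g k` lies in `G`.
    have hsm : Summable fun k => (∫⁻ t, u x k t).toReal := by
      refine Summable.of_norm_bounded_eventually_nat (g := fun k : ℕ => x * (1 / 4 : ℝ) ^ k)
        ((summable_geometric_of_lt_one (by norm_num) (by norm_num)).mul_left x) ?_
      filter_upwards [(tendsto_pow_atTop_atTop_of_one_lt
        (show (1 : ℝ) < 4 by norm_num)).eventually_ge_atTop x] with k hk
      rw [Real.norm_of_nonneg ENNReal.toReal_nonneg]
      refine ENNReal.toReal_le_of_le_ofReal (by positivity) ?_
      calc ∫⁻ t, u x k t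
          ≤ ∫⁻ t, ENNReal.ofReal (x * (1 / 4 : ℝ) ^ k) * ENNReal.ofReal (M2 |g k t|) := by
            refine lintegral_mono fun t => ?_
            simp only [u, ← ENNReal.ofReal_mul (show 0 ≤ x * (1 / 4 : ℝ) ^ k by positivity)]
            refine ENNReal.ofReal_le_ofReal ?_
            have h4 : ((2 : ℝ) ^ k) ^ 2 = 4 ^ k := by
              rw [← pow_mul, mul_comm, pow_mul]; norm_num
            have e : x * (|g k t| / 2 ^ k) ^ 2 = x * (1 / 4) ^ k * |g k t| ^ 2 := by
              rw [div_pow, h4, one_div_pow]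
              ring
            rw [e, M2]
            refine exp_mul_sub_one_le (by positivity) ?_
            rw [one_div_pow, mul_one_div, div_le_one (by positivity)]
            exact hk
        _ ≤ ENNReal.ofReal (x * (1 / 4 : ℝ) ^ k) := by
            rw [lintegral_const_mul' _ _ ENNReal.ofReal_ne_top]
            exact mul_le_of_le_one_right' (hg1 k)
    have := hsm.tsum_ofReal_ne_top
    simpa only [ENNReal.ofReal_toReal (hfin _)] using this
  have hae : ∀ᵐ t, ∑' k, u 1 k t < ∞ :=
    ae_lt_top (Measurable.tsum fun k => hum 1 k) (hsum 1 one_pos)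
  have hle : ∀ᵐ t, ∀ k, |g k t| / 2 ^ k ≤ h t := by
    filter_upwards [hae] with t ht k
    refine le_ciSup (f := fun k => |g k t| / 2 ^ k) ⟨1 + (∑' k, u 1 k t).toReal, ?_⟩ k
    rintro _ ⟨j, rfl⟩
    have h1 : (|g j t| / 2 ^ j) ^ 2 ≤ (∑' k, u 1 k t).toReal := by
      have h2 := ENNReal.toReal_mono ht.ne (ENNReal.le_tsum (f := fun k => u 1 k t) j)
      refine le_trans ?_ h2
      simp only [u, one_mul]
      rw [ENNReal.toReal_ofReal (sub_nonneg.2 (Real.one_le_exp (by positivity)))]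
      linarith [Real.add_one_le_exp ((|g j t| / 2 ^ j) ^ 2)]
    have h3 : (0 : ℝ) ≤ |g j t| / 2 ^ j := by positivity
    simp only
    nlinarith [sq_nonneg (|g j t| / 2 ^ j - 1)]
  have hH := AEEqFun.coeFn_mk h hm.aestronglyMeasurable (μ := (volume : Measure I))
  have hmom : AllSqExpMoments (AEEqFun.mk h hm.aestronglyMeasurable) := by
    intro x hx
    have hpt : ∀ᵐ t : I, ENNReal.ofReal
        (Real.exp (x * (AEEqFun.mk h hm.aestronglyMeasurable : L0) t ^ 2)) ≤
        1 + ∑' k, u x k t := by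
      filter_upwards [hH] with t ht
      rw [ht]
      rcases eq_or_ne (∑' k, u x k t) ∞ with htop | htop
      · simp [htop]
      set s := (∑' k, u x k t).toReal with hs
      have hs0 : 0 ≤ s := ENNReal.toReal_nonneg
      have hlog : 0 ≤ Real.log (1 + s) := Real.log_nonneg (by linarith)
      -- Each term of the series is at most its sum `s`, so the supremum satisfies `exp (x * h t ^
      -- 2) ≤ 1 + s`.
      have hk : h t ≤ Real.sqrt (Real.log (1 + s) / x) := by
        refine ciSup_le fun k => Real.le_sqrt_of_sq_le ?_
        have h2 := ENNReal.toReal_mono htop (ENNReal.le_tsum (f := fun k => u x k t) k)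
        simp only [u] at h2
        rw [ENNReal.toReal_ofReal (sub_nonneg.2 (Real.one_le_exp (by positivity)))] at h2
        rw [le_div_iff₀ hx, mul_comm, Real.le_log_iff_exp_le (by linarith)]
        linarith
      have h3 : h t ^ 2 ≤ Real.log (1 + s) / x :=
        (pow_le_pow_left₀ (hh0 t) hk 2).trans_eq (Real.sq_sqrt (by positivity))
      rw [le_div_iff₀ hx, mul_comm, Real.le_log_iff_exp_le (by linarith)] at h3
      refine (ENNReal.ofReal_le_ofReal h3).trans_eq ?_
      rw [ENNReal.ofReal_add zero_le_one hs0, ENNReal.ofReal_one, hs, ENNReal.ofReal_toReal htop]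
    refine lt_of_le_of_lt (lintegral_mono_ae hpt) ?_
    rw [lintegral_add_left measurable_const]
    exact ENNReal.add_lt_top.2 ⟨by simp, (hsum x hx).lt_top⟩
  have hHX : X.extNorm (AEEqFun.mk h hm.aestronglyMeasurable) < ∞ := hX hmom.mem_spaceG
  set H : L0 := AEEqFun.mk h hm.aestronglyMeasurable
  have hlow : ∀ k : ℕ, ENNReal.ofReal (2 ^ k) ≤ X.extNorm H := by
    intro k
    have h1 : X.extNorm ((1 / 2 ^ k : ℝ) • g k) ≤ X.extNorm H := by
      refine X.extNorm_mono _ _ ?_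
      filter_upwards [AEEqFun.coeFn_smul (1 / 2 ^ k : ℝ) (g k), hle, hH] with t h1 h2 h3
      rw [h1, h3, Pi.smul_apply, smul_eq_mul, abs_mul, abs_of_pos (by positivity),
        one_div_mul_eq_div, abs_of_nonneg (hh0 t)]
      exact h2 k
    rw [X.extNorm_smul, abs_of_pos (by positivity)] at h1
    refine le_trans ?_ h1
    refine le_trans (le_of_eq ?_) (mul_le_mul_right (hgK k).le _)
    rw [← ENNReal.ofReal_mul (by positivity)]
    congr 1
    rw [show (4 : ℝ) = 2 * 2 by norm_num, mul_pow]
    field_simp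
  obtain ⟨k, hk⟩ := pow_unbounded_of_one_lt (X.extNorm H).toReal (one_lt_two (α := ℝ))
  have := ENNReal.toReal_mono hHX.ne (hlow k)
  rw [ENNReal.toReal_ofReal (by positivity)] at this
  linarith

variable {X}

/-- Here `γ` is the norm of the indicator of `[0, η]`. The function `|g|` dominates `s` times the
indicator of its level set, which is equimeasurable with that of an initial interval containing `[0,
η]`. -/
theorem exists_mul_le_extNorm (hri : X.IsRearrangementInvariant)
    (hX : spaceG ⊆ (X.carrier : Set L0)) {η : ℝ} (hη0 : 0 < η) (hη1 : η ≤ 1) :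
    ∃ γ : ℝ, 0 < γ ∧ ∀ (g : L0) (s : ℝ), 0 ≤ s → η ≤ volume.real {t : I | s < |g t|} →
      ENNReal.ofReal (γ * s) ≤ X.extNorm g := by
  have hind : ∀ A : Set I, MeasurableSet A →
      AEStronglyMeasurable (A.indicator (1 : I → ℝ)) (volume : Measure I) := fun A hA =>
    (measurable_one.indicator hA).aestronglyMeasurable
  have hindG : ∀ (A : Set I) (hA : MeasurableSet A), AEEqFun.mk _ (hind A hA) ∈ X.carrier := by
    intro A hA
    refine hX (allSqExpMoments_of_bound (R := 1) ?_).mem_spaceG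
    filter_upwards [AEEqFun.coeFn_mk _ (hind A hA)] with t ht
    rw [ht]
    by_cases h : t ∈ A <;> simp [h]
  have hdist : ∀ (A : Set I) (hA : MeasurableSet A) (s : ℝ), 0 < s →
      distribution (AEEqFun.mk _ (hind A hA)) s = if s < 1 then volume A else 0 := by
    intro A hA s hs
    have h1 : distribution (AEEqFun.mk _ (hind A hA)) s =
        volume {t : I | s < |A.indicator (1 : I → ℝ) t|} := by
      refine measure_congr ?_
      filter_upwards [AEEqFun.coeFn_mk _ (hind A hA)] with t ht
      refine propext ?_
      change s < |_| ↔ s < |_|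
      rw [ht]
    rw [h1]
    split_ifs with hs1
    · congr 1
      ext t
      by_cases h : t ∈ A
      · simp [h, hs1]
      · simp [h, hs.le]
    · rw [measure_eq_zero_iff_ae_notMem]
      refine ae_of_all _ fun t ht => hs1 ?_
      have ht' : s < |A.indicator (1 : I → ℝ) t| := ht
      by_cases h : t ∈ A
      · simpa [h] using ht'
      · simp only [h, not_false_eq_true, indicator_of_notMem, abs_zero] at ht'
        linarith
  set e : L0 := AEEqFun.mk _ (hind (Iic (⟨η, hη0.le, hη1⟩ : I)) measurableSet_Iic)
  have he0 : X.extNorm e ≠ 0 := fun h0 => by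
    have h1 := X.eq_zero_of_extNorm_eq_zero e h0
    have h2 := hdist (Iic (⟨η, hη0.le, hη1⟩ : I)) measurableSet_Iic (1 / 2) (by norm_num)
    rw [if_pos (by norm_num), unitInterval.volume_Iic] at h2
    have h3 : distribution e (1 / 2) = 0 := by
      rw [distribution, measure_eq_zero_iff_ae_notMem, h1]
      filter_upwards [AEEqFun.coeFn_zero (α := I) (β := ℝ) (μ := volume)] with t ht hmem
      change _ < |_| at hmem
      rw [ht] at hmem
      norm_num at hmem
    have h4 := h3.symm.trans h2
    rw [eq_comm, ENNReal.ofReal_eq_zero] at h4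
    exact absurd hη0 (not_lt.2 h4)
  have hetop : X.extNorm e ≠ ∞ := LT.lt.ne (hindG _ measurableSet_Iic)
  refine ⟨(X.extNorm e).toReal, ENNReal.toReal_pos he0 hetop, fun g s hs hg => ?_⟩
  have hA : MeasurableSet {t : I | s < |g t|} := measurableSet_lt measurable_const g.measurable.abs
  set A := {t : I | s < |g t|}
  set x : I := ⟨volume.real A, measureReal_nonneg, measureReal_le_one⟩
  have h1 : X.extNorm e ≤ X.extNorm (AEEqFun.mk _ (hind (Iic x) measurableSet_Iic)) := by
    refine X.extNorm_mono _ _ ?_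
    filter_upwards [AEEqFun.coeFn_mk _ (hind (Iic x) measurableSet_Iic),
      AEEqFun.coeFn_mk _ (hind (Iic (⟨η, hη0.le, hη1⟩ : I)) measurableSet_Iic)] with t h1 h2
    rw [h1, h2]
    by_cases h : t ∈ Iic (⟨η, hη0.le, hη1⟩ : I)
    · have h' : t ∈ Iic x := le_trans (mem_Iic.1 h) hg
      rw [indicator_of_mem h, indicator_of_mem h']
    · rw [indicator_of_notMem h, abs_zero]
      exact abs_nonneg _
  have h2 : X.extNorm (AEEqFun.mk _ (hind A hA)) =
      X.extNorm (AEEqFun.mk _ (hind (Iic x) measurableSet_Iic)) := by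
    refine (hri _ _ (fun s hs => ?_) (hindG (Iic x) measurableSet_Iic)).2
    have hx : ENNReal.ofReal (x : ℝ) = volume A := ENNReal.ofReal_toReal (measure_ne_top _ _)
    rw [hdist _ measurableSet_Iic s hs, hdist _ hA s hs, unitInterval.volume_Iic, hx]
  have h3 : X.extNorm (s • AEEqFun.mk _ (hind A hA)) ≤ X.extNorm g := by
    refine X.extNorm_mono _ _ ?_
    filter_upwards [AEEqFun.coeFn_mk _ (hind A hA),
      AEEqFun.coeFn_smul s (AEEqFun.mk _ (hind A hA))] with t h1 h2
    rw [h2, Pi.smul_apply, h1]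
    by_cases h : t ∈ A
    · have h' : s < |g t| := h
      simp [h, abs_of_nonneg hs, h'.le]
    · simp [h]
  rw [X.extNorm_smul, abs_of_nonneg hs, h2] at h3
  refine le_trans ?_ h3
  rw [mul_comm, ENNReal.ofReal_mul hs, ENNReal.ofReal_toReal hetop]
  exact mul_le_mul_right h1 _

end BanachFunctionSpace

/-! ### Walsh series in `L²` -/

theorem coeFn_walshL2 (n : ℕ) : walshL2 n =ᵐ[volume] walshSign n :=
  (MemLp.coeFn_toLp (memLp_walsh n)).trans (walsh_ae_eq_walshSign n)

theorem orthonormal_walshL2 : Orthonormal ℝ walshL2 := by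
  rw [orthonormal_iff_ite]
  intro m n
  have h1 : inner ℝ (walshL2 m) (walshL2 n) = ∫ t, 1 * walshSign (m ^^^ n) t := by
    rw [L2.inner_def]
    refine integral_congr_ae ?_
    filter_upwards [coeFn_walshL2 m, coeFn_walshL2 n] with t h1 h2
    rw [h1, h2, one_mul, ← walshSign_mul, real_inner_eq_re_inner]
    simp [mul_comm]
  rw [h1]
  split_ifs with h
  · simp [h]
  · refine integral_mul_walshSign (DyadicStep.const (j := 0) 1) ?_
    exact Nat.one_le_iff_ne_zero.2 fun h0 => h (Nat.xor_eq_zero_iff.1 h0)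

theorem summable_smul_walshL2 {n : ℕ → ℕ} (hn : Function.Injective n) {a : ℕ → ℝ}
    (ha : Summable fun k => a k ^ 2) : Summable fun k => a k • walshL2 (n k) := by
  have h := (orthonormal_walshL2.comp n hn).orthogonalFamily.summable_iff_norm_sq_summable a
  simp only [LinearIsometry.toSpanSingleton_apply, Function.comp_apply, Real.norm_eq_abs,
    sq_abs] at h
  exact h.2 ha

theorem coeFn_sum_walshL2 (a : ℕ → ℝ) (n : ℕ → ℕ) (F : Finset ℕ) :
    (∑ k ∈ F, a k • walshL2 (n k) : Lp ℝ 2 (volume : Measure I)) =ᵐ[volume]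
      walshSum a n F := by
  have h1 := Lp.coeFn_finsetSum (μ := (volume : Measure I)) F fun k => a k • walshL2 (n k)
  have h2 : ∀ᵐ t : I, ∀ k ∈ F, (a k • walshL2 (n k) : Lp ℝ 2 (volume : Measure I)) t =
      a k * walshSign (n k) t := by
    refine (ae_ball_iff F.countable_toSet).2 ?_
    intro k _
    filter_upwards [Lp.coeFn_smul (a k) (walshL2 (n k)), coeFn_walshL2 (n k)] with t h1 h2
    rw [h1, Pi.smul_apply, h2, smul_eq_mul]
  filter_upwards [h1, h2] with t h1 h2
  rw [h1, Finset.sum_apply]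
  exact Finset.sum_congr rfl h2

/-- Fatou's lemma along a subsequence converging almost everywhere. -/
theorem setLIntegral_comp_le_of_tendsto_Lp {U : ℕ → Lp ℝ 2 (volume : Measure I)}
    {f : Lp ℝ 2 (volume : Measure I)} (hU : Tendsto U atTop (𝓝 f)) {ψ : ℝ → ℝ≥0∞}
    (hψ : Continuous ψ) {E : Set I} {b : ℝ≥0∞} (hb : ∀ M, ∫⁻ t in E, ψ (U M t) ≤ b) :
    ∫⁻ t in E, ψ (f t) ≤ b := by
  obtain ⟨ns, _, hns⟩ := (tendstoInMeasure_of_tendsto_Lp hU).exists_seq_tendsto_ae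
  calc ∫⁻ t in E, ψ (f t)
      = ∫⁻ t in E, liminf (fun i => ψ (U (ns i) t)) atTop := by
        refine lintegral_congr_ae (ae_restrict_of_ae ?_)
        filter_upwards [hns] with t ht
        exact (((hψ.tendsto _).comp ht).liminf_eq).symm
    _ ≤ liminf (fun i => ∫⁻ t in E, ψ (U (ns i) t)) atTop :=
        lintegral_liminf_le fun i => hψ.measurable.comp (Lp.stronglyMeasurable _).measurable
    _ ≤ b := by
        refine (liminf_le_liminf (Eventually.of_forall fun i => hb (ns i))).trans ?_
        simp

/-! ### Transfer to the local space -/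

/-- The function `f ∘ ρ_E⁻¹` on `[0,1]`. -/
def pullRho (E : Set I) (hE : 0 < volume E) (f : L0) : L0 :=
  (restrictTo E f).compQuasiMeasurePreserving (rhoInv E) (quasiMeasurePreserving_rhoInv hE)

theorem coeFn_pullRho {E : Set I} (hE : 0 < volume E) (f : L0) :
    pullRho E hE f =ᵐ[volume] fun t => f (rhoInv E t) := by
  have h1 := AEEqFun.coeFn_compQuasiMeasurePreserving (restrictTo E f)
    (quasiMeasurePreserving_rhoInv hE)
  have h2 := (quasiMeasurePreserving_rhoInv hE).ae
    (AEEqFun.coeFn_mk f f.aestronglyMeasurable.restrict)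
  filter_upwards [h1, h2] with t h1 h2
  exact h1.trans h2

theorem ae_pullRho {E : Set I} (hE : 0 < volume E) {p : I → Prop} (h : ∀ᵐ t, p t) :
    ∀ᵐ t, p (rhoInv E t) :=
  (quasiMeasurePreserving_rhoInv hE).ae (ae_restrict_of_ae h)

theorem pullRho_sub {E : Set I} (hE : 0 < volume E) (f g : L0) :
    pullRho E hE (f - g) = pullRho E hE f - pullRho E hE g := by
  refine AEEqFun.ext ?_
  filter_upwards [coeFn_pullRho hE (f - g), coeFn_pullRho hE f, coeFn_pullRho hE g,
    AEEqFun.coeFn_sub (pullRho E hE f) (pullRho E hE g),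
    ae_pullRho hE (AEEqFun.coeFn_sub f g)] with t h1 h2 h3 h4 h5
  rw [h1, h4, Pi.sub_apply, h2, h3, h5, Pi.sub_apply]

theorem lintegral_comp_pullRho {E : Set I} (hE : 0 < volume E) (f : L0) {ψ : ℝ → ℝ≥0∞}
    (hψ : Measurable ψ) :
    ∫⁻ t, ψ (pullRho E hE f t) = (volume E)⁻¹ * ∫⁻ t in E, ψ (f t) := by
  calc ∫⁻ t, ψ (pullRho E hE f t) = ∫⁻ t, ψ (f (rhoInv E t)) := by
        refine lintegral_congr_ae ?_
        filter_upwards [coeFn_pullRho hE f] with t ht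
        rw [ht]
    _ = ∫⁻ t, ψ (f t) ∂(Measure.map (rhoInv E) volume) :=
        (lintegral_map (hψ.comp f.measurable) (measurable_rhoInv hE)).symm
    _ = _ := by rw [map_rhoInv hE, lintegral_smul_measure, smul_eq_mul]

theorem volume_pullRho_preimage {E : Set I} (hE : 0 < volume E) (f : L0) {T : Set ℝ}
    (hT : MeasurableSet T) :
    volume (pullRho E hE f ⁻¹' T) = (volume E)⁻¹ * volume (E ∩ f ⁻¹' T) := by
  have h := lintegral_comp_pullRho hE f (ψ := T.indicator 1) (measurable_one.indicator hT)
  have h1 : ∀ (g : L0) t, T.indicator (1 : ℝ → ℝ≥0∞) (g t) = (g ⁻¹' T).indicator 1 t :=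
    fun g t => rfl
  simp only [h1] at h
  rwa [lintegral_indicator_one ((pullRho E hE f).measurable hT),
    lintegral_indicator_one (f.measurable hT), Measure.restrict_apply (f.measurable hT),
    inter_comm] at h

/-! ### Lacunary series on `E` -/

/-- The sequence is subgaussian on `E`, with a constant that does not depend on `E`. -/
def LocallySubgaussian (κ : ℝ) (E : Set I) (n : ℕ → ℕ) : Prop :=
  ∀ (a : ℕ → ℝ) (F : Finset ℕ) (V : ℝ), 0 < V → ∑ k ∈ F, a k ^ 2 ≤ V →
    ∫ t in E, (Real.exp (walshSum a n F t ^ 2 / (6 * κ * V)) - 1) ≤ volume.real E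

theorem LocallySubgaussian.shift {κ : ℝ} {E : Set I} {n : ℕ → ℕ}
    (h : LocallySubgaussian κ E n) (K : ℕ) : LocallySubgaussian κ E fun k => n (k + K) := by
  intro a F V hV ha
  -- Truncated subtraction is harmless, since the shifted index set contains only `k ≥ K`.
  have h1 := h (fun k => a (k - K)) (F.map (addRightEmbedding K)) V hV (by simpa using ha)
  have h2 : walshSum (fun k => a (k - K)) n (F.map (addRightEmbedding K)) =
      walshSum a (fun k => n (k + K)) F := by
    funext t
    simp [walshSum]
  rwa [h2] at h1

theorem LocallySubgaussian.lintegral_M2_le {κ : ℝ} (hκ : 0 < κ) {E : Set I} {n : ℕ → ℕ}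
    (h : LocallySubgaussian κ E n) {a : ℕ → ℝ} (ha : Summable fun k => a k ^ 2)
    {f : Lp ℝ 2 (volume : Measure I)} (hf : HasSum (fun k => a k • walshL2 (n k)) f)
    {c : ℝ} (hc : 0 < c) (hac : 6 * κ * ∑' k, a k ^ 2 ≤ c ^ 2) :
    ∫⁻ t in E, ENNReal.ofReal (M2 (|f t| / c)) ≤ volume E := by
  refine setLIntegral_comp_le_of_tendsto_Lp hf.tendsto_sum_nat
    (ψ := fun x => ENNReal.ofReal (M2 (|x| / c)))
    (ENNReal.continuous_ofReal.comp (continuous_M2.comp (continuous_abs.div_const c)))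
    fun M => ?_
  have h1 := h a (Finset.range M) (c ^ 2 / (6 * κ)) (by positivity) (by
    rw [le_div_iff₀ (by positivity), mul_comm]
    refine le_trans ?_ hac
    gcongr
    exact ha.sum_le_tsum _ fun _ _ => sq_nonneg _)
  rw [mul_div_cancel₀ _ (by positivity)] at h1
  obtain ⟨J, -, hJ⟩ := exists_dyadicStep_walshSum a n (Finset.range M) 0
  have hint : Integrable (fun t => Real.exp (walshSum a n (Finset.range M) t ^ 2 / c ^ 2) - 1)
      (volume.restrict E) :=
    (hJ.comp fun z => Real.exp (z ^ 2 / c ^ 2) - 1).integrable.restrict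
  calc ∫⁻ t in E, ENNReal.ofReal (M2
        (|(∑ k ∈ Finset.range M, a k • walshL2 (n k) : Lp ℝ 2 (volume : Measure I)) t| / c))
      = ∫⁻ t in E, ENNReal.ofReal
        (Real.exp (walshSum a n (Finset.range M) t ^ 2 / c ^ 2) - 1) := by
        refine lintegral_congr_ae (ae_restrict_of_ae ?_)
        filter_upwards [coeFn_sum_walshL2 a n (Finset.range M)] with t ht
        rw [ht, M2_abs_div]
    _ = ENNReal.ofReal
        (∫ t in E, (Real.exp (walshSum a n (Finset.range M) t ^ 2 / c ^ 2) - 1)) :=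
        (ofReal_integral_eq_lintegral_ofReal hint (ae_of_all _ fun t =>
          sub_nonneg.2 (Real.one_le_exp (by positivity)))).symm
    _ ≤ ENNReal.ofReal (volume.real E) := ENNReal.ofReal_le_ofReal h1
    _ = volume E := ENNReal.ofReal_toReal (measure_ne_top _ _)

theorem LocallySubgaussian.lintegral_pullRho_le {κ : ℝ} (hκ : 0 < κ) {E : Set I}
    (hE : 0 < volume E) {n : ℕ → ℕ}
    (h : LocallySubgaussian κ E n) {a : ℕ → ℝ} (ha : Summable fun k => a k ^ 2)
    {f : Lp ℝ 2 (volume : Measure I)} (hf : HasSum (fun k => a k • walshL2 (n k)) f)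
    {c : ℝ} (hc : 0 < c) (hac : 6 * κ * ∑' k, a k ^ 2 ≤ c ^ 2) :
    ∫⁻ t, ENNReal.ofReal (M2 (|pullRho E hE f t| / c)) ≤ 1 := by
  rw [lintegral_comp_pullRho hE f (ψ := fun x => ENNReal.ofReal (M2 (|x| / c)))
    (ENNReal.continuous_ofReal.comp (continuous_M2.comp (continuous_abs.div_const c))).measurable]
  calc _ ≤ (volume E)⁻¹ * volume E :=
        mul_le_mul_right (h.lintegral_M2_le hκ ha hf hc hac) _
    _ = 1 := ENNReal.inv_mul_cancel hE.ne' (measure_ne_top _ _)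

/-- A partial sum is bounded, and the remaining tail is subgaussian with the same `κ` and
arbitrarily small ℓ² norm, so it is small at every scale. This yields membership in `G`, not merely
in the Orlicz space. -/
theorem LocallySubgaussian.allSqExpMoments {κ : ℝ} (hκ : 0 < κ) {E : Set I}
    (hE : 0 < volume E) {n : ℕ → ℕ}
    (h : LocallySubgaussian κ E n) {a : ℕ → ℝ} (ha : Summable fun k => a k ^ 2)
    {f : Lp ℝ 2 (volume : Measure I)} (hf : HasSum (fun k => a k • walshL2 (n k)) f) :
    AllSqExpMoments (pullRho E hE f) := by
  refine allSqExpMoments_of_approx fun c hc => ?_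
  have htail := tendsto_sum_nat_add fun k => a k ^ 2
  obtain ⟨K, hK⟩ := (htail.eventually_le_const
    (show 0 < c ^ 2 / (6 * κ) by positivity)).exists
  have hsh := (hasSum_nat_add_iff' K).2 hf
  set P : Lp ℝ 2 (volume : Measure I) := ∑ k ∈ Finset.range K, a k • walshL2 (n k) with hP
  have hPm := coeFn_sum_walshL2 a n (Finset.range K)
  obtain ⟨J, -, hJ⟩ := exists_dyadicStep_walshSum a n (Finset.range K) 0
  obtain ⟨R, hR⟩ := hJ.exists_bound
  refine ⟨pullRho E hE P, R, ?_, ?_⟩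
  · filter_upwards [coeFn_pullRho hE P, ae_pullRho hE hPm] with t h1 h2
    rw [h1]
    exact (congrArg abs h2).trans_le (hR _)
  · rw [← pullRho_sub, ← AddSubgroupClass.coe_sub]
    exact (h.shift K).lintegral_pullRho_le hκ hE ((summable_nat_add_iff K).2 ha) hsh hc (by
      rw [le_div_iff₀ (by positivity), mul_comm] at hK
      exact hK)

/-- After division by any `c > 0` with `c ^ 2 ≥ 6 * κ * ∑ a k ^ 2` the function lies in the unit
ball of `G`. -/
theorem LocallySubgaussian.extNorm_le {κ : ℝ} (hκ : 0 < κ) {E : Set I}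
    (hE : 0 < volume E) {n : ℕ → ℕ} (h : LocallySubgaussian κ E n)
    {X : BanachFunctionSpace} {C : ℝ}
    (hC : ∀ g ∈ spaceG, ∫⁻ t : I, ENNReal.ofReal (M2 |g t|) ≤ 1 → X.extNorm g ≤ ENNReal.ofReal C)
    {a : ℕ → ℝ} (ha : Summable fun k => a k ^ 2)
    {f : Lp ℝ 2 (volume : Measure I)} (hf : HasSum (fun k => a k • walshL2 (n k)) f) :
    X.extNorm (pullRho E hE f) ≤
      ENNReal.ofReal (C * Real.sqrt (6 * κ) * Real.sqrt (∑' k, a k ^ 2)) := by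
  have hv : 0 ≤ ∑' k, a k ^ 2 := tsum_nonneg fun _ => sq_nonneg _
  set g : L0 := pullRho E hE f
  have key : ∀ c : ℝ, 0 < c → 6 * κ * ∑' k, a k ^ 2 ≤ c ^ 2 →
      X.extNorm g ≤ ENNReal.ofReal (C * c) := by
    intro c hc hac
    have hsm := AEEqFun.coeFn_smul c⁻¹ g
    have hG : c⁻¹ • g ∈ spaceG := by
      refine ((h.allSqExpMoments hκ hE ha hf).of_sq_le (c := c⁻¹) ?_).mem_spaceG
      filter_upwards [hsm] with t ht
      rw [ht, Pi.smul_apply, smul_eq_mul, mul_pow]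
    have h1 := hC _ hG (by
      refine le_trans (le_of_eq (lintegral_congr_ae ?_)) (h.lintegral_pullRho_le hκ hE ha hf hc hac)
      filter_upwards [hsm] with t ht
      rw [ht, Pi.smul_apply, smul_eq_mul, abs_mul, abs_of_pos (inv_pos.2 hc), inv_mul_eq_div])
    calc X.extNorm g = X.extNorm (c • c⁻¹ • g) := by
          rw [smul_smul, mul_inv_cancel₀ hc.ne', one_smul]
      _ = ENNReal.ofReal c * X.extNorm (c⁻¹ • g) := by rw [X.extNorm_smul, abs_of_pos hc]
      _ ≤ ENNReal.ofReal c * ENNReal.ofReal C := mul_le_mul_right h1 _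
      _ = _ := by rw [← ENNReal.ofReal_mul hc.le, mul_comm]
  rw [mul_assoc, ← Real.sqrt_mul (by positivity)]
  -- Approaching the optimal `c` from above also covers zero coefficients, where the optimal value
  -- is `0` and not admissible.
  have hlim : Tendsto (fun x : ℝ => ENNReal.ofReal (C * (Real.sqrt (6 * κ * ∑' k, a k ^ 2) + x)))
      (𝓝[>] 0) (𝓝 (ENNReal.ofReal (C * (Real.sqrt (6 * κ * ∑' k, a k ^ 2) + 0)))) :=
    tendsto_nhdsWithin_of_tendsto_nhds 
      ((ENNReal.continuous_ofReal.comp (by fun_prop)).tendsto 0)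
  rw [add_zero] at hlim
  refine ge_of_tendsto hlim ?_
  filter_upwards [self_mem_nhdsWithin] with x hx
  have hx0 : (0 : ℝ) < x := hx
  refine key _ (by positivity) ?_
  calc 6 * κ * ∑' k, a k ^ 2 = Real.sqrt (6 * κ * ∑' k, a k ^ 2) ^ 2 :=
        (Real.sq_sqrt (by positivity)).symm
    _ ≤ _ := by gcongr; linarith

end LacunaryWalsh

end

/-! ### The two-sided estimate in `X|E` -/

open LacunaryWalsh in
theorem corollary3p3 (q : ℝ) (hq : 1 < q) :
    ∃ N : Set I → ℕ, ∀ X : LacunaryWalsh.BanachFunctionSpace, X.IsRearrangementInvariant →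
      LacunaryWalsh.spaceG ⊆ X.carrier →
      ∃ A B : ℝ, 0 < A ∧ 0 < B ∧
        ∀ (E : Set I) (_ : NullMeasurableSet E volume) (hE : 0 < volume E) (n : ℕ → ℕ),
          LacunaryWalsh.IsLacunary q n → (∀ k, N E ≤ n k) →
          ∀ a : ℕ → ℝ, Summable (fun k => a k ^ 2) →
            ∃ f : Lp ℝ 2 (volume : Measure I),
              HasSum (fun k => a k • LacunaryWalsh.walshL2 (n k)) f ∧
              ENNReal.ofReal (A * Real.sqrt (∑' k, a k ^ 2)) ≤
                X.localNorm E hE (LacunaryWalsh.restrictTo E f) ∧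
              X.localNorm E hE (LacunaryWalsh.restrictTo E f) ≤
                ENNReal.ofReal (B * Real.sqrt (∑' k, a k ^ 2)) := by
  obtain ⟨L, hL⟩ := pow_unbounded_of_one_lt 2 hq
  have hL0 : 0 < L := Nat.pos_of_ne_zero fun h => by
    rw [h, pow_zero] at hL
    norm_num at hL
  set κ := varianceFactor L
  have hκ1 : 1 ≤ κ := one_le_varianceFactor hL0
  have hκ : 0 < κ := by linarith
  have hN : ∀ E : Set I, ∃ N : ℕ, NullMeasurableSet E volume → 0 < volume E →
      ∀ n : ℕ → ℕ, IsLacunary q n → (∀ k, N ≤ n k) → ∀ (a : ℕ → ℝ) (F : Finset ℕ),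
      (∀ V, 0 < V → ∑ k ∈ F, a k ^ 2 ≤ V →
        ∫ t in E, (Real.exp (walshSum a n F t ^ 2 / (6 * κ * V)) - 1) ≤ volume.real E) ∧
      volume.real E * (∑ k ∈ F, a k ^ 2) / 2 ≤ ∫ t in E, walshSum a n F t ^ 2 := by
    intro E
    -- The threshold is fixed before `X` appears; sets outside the theorem's scope receive the dummy
    -- value `0`.
    by_cases h : NullMeasurableSet E volume ∧ 0 < volume E
    · obtain ⟨N, hN⟩ := exists_local_bounds hq hL0 hL.le h.1
        (ENNReal.toReal_pos h.2.ne' (measure_ne_top _ _))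
      exact ⟨N, fun _ _ => hN⟩
    · exact ⟨0, fun h1 h2 => absurd ⟨h1, h2⟩ h⟩
  choose N hN using hN
  refine ⟨N, fun X hri hX => ?_⟩
  obtain ⟨C, hC0, hC⟩ := X.exists_extNorm_le_of_spaceG_subset hX
  obtain ⟨γ, hγ0, hγ⟩ := BanachFunctionSpace.exists_mul_le_extNorm hri hX
    (η := 1 / (1152 * κ ^ 2)) (by positivity) (by
      rw [div_le_one (by positivity)]
      nlinarith)
  refine ⟨γ / 2, C * Real.sqrt (6 * κ), by positivity, by positivity,
    fun E hEm hE n hn hNn a ha => ?_⟩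
  have hE' : 0 < volume.real E := ENNReal.toReal_pos hE.ne' (measure_ne_top _ _)
  have hb := hN E hEm hE n hn hNn
  have hsub : LocallySubgaussian κ E n := fun a F => (hb a F).1
  obtain ⟨f, hf⟩ := summable_smul_walshL2 (hn.strictMono hq).injective ha
  have hup : X.extNorm (pullRho E hE f) ≤ _ := hsub.extNorm_le hκ hE hC ha hf
  refine ⟨f, hf, ?_, hup⟩
  change _ ≤ X.extNorm (pullRho E hE f)
  -- The Paley–Zygmund bound concerns finite sums. The tail costs at most its upper estimate, which
  -- tends to `0` as `K` grows.
  have hpart : ∀ K : ℕ, ENNReal.ofReal (γ / 2 * Real.sqrt (∑ k ∈ Finset.range K, a k ^ 2)) ≤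
      X.extNorm (pullRho E hE f) +
        ENNReal.ofReal (C * Real.sqrt (6 * κ) * Real.sqrt (∑' k, a (k + K) ^ 2)) := by
    intro K
    set v := ∑ k ∈ Finset.range K, a k ^ 2
    set P : Lp ℝ 2 (volume : Measure I) := ∑ k ∈ Finset.range K, a k • walshL2 (n k) with hP
    have h1 : ENNReal.ofReal (γ / 2 * Real.sqrt v) ≤ X.extNorm (pullRho E hE P) := by
      have hv0 : 0 ≤ v := Finset.sum_nonneg fun k _ => sq_nonneg (a k)
      rcases hv0.eq_or_lt with h0 | hv
      · simp [← h0]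
      obtain ⟨J, -, hJ⟩ := exists_dyadicStep_walshSum a n (Finset.range K) 0
      have h2 := le_measureReal_lt_sq hJ hκ hv (hb a _).2 ((hb a _).1 v hv le_rfl)
      have h3 := hγ (pullRho E hE P) (Real.sqrt v / 2) (by positivity) (by
        have e1 := volume_pullRho_preimage hE (P : L0)
          (T := {x : ℝ | Real.sqrt v / 2 < |x|})
          (measurableSet_lt measurable_const measurable_id.abs)
        have e2 : volume (E ∩ (P : I → ℝ) ⁻¹' {x : ℝ | Real.sqrt v / 2 < |x|}) =
            volume (E ∩ {t | v / 4 < walshSum a n (Finset.range K) t ^ 2}) := by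
          refine measure_congr ?_
          filter_upwards [coeFn_sum_walshL2 a n (Finset.range K)] with t ht
          refine propext (and_congr Iff.rfl ?_)
          change Real.sqrt v / 2 < |P t| ↔ v / 4 < _
          rw [ht, ← sq_lt_sq₀ (by positivity) (abs_nonneg _), sq_abs, div_pow,
            Real.sq_sqrt hv.le]
          norm_num
        rw [e2] at e1
        change _ ≤ volume.real (pullRho E hE P ⁻¹' {x : ℝ | Real.sqrt v / 2 < |x|})
        rw [Measure.real, e1, ENNReal.toReal_mul, ENNReal.toReal_inv, inv_mul_eq_div]
        change _ ≤ _ / volume.real E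
        rw [le_div_iff₀ hE', one_div_mul_eq_div]
        exact h2)
      rwa [show γ * (Real.sqrt v / 2) = γ / 2 * Real.sqrt v by ring] at h3
    have h4 := (hsub.shift K).extNorm_le hκ hE hC ((summable_nat_add_iff K).2 ha)
      ((hasSum_nat_add_iff' K).2 hf)
    rw [← hP, AddSubgroupClass.coe_sub, pullRho_sub] at h4
    have h5 : pullRho E hE P = pullRho E hE f +
        (-1 : ℝ) • (pullRho E hE f - pullRho E hE P) := by
      rw [neg_one_smul]
      abel
    have h6 := X.extNorm_add_le (pullRho E hE f)
      ((-1 : ℝ) • (pullRho E hE f - pullRho E hE P))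
    rw [← h5, X.extNorm_smul, abs_neg, abs_one, ENNReal.ofReal_one, one_mul] at h6
    exact h1.trans (h6.trans (add_le_add le_rfl h4))
  have hl1 : Tendsto (fun K : ℕ => ENNReal.ofReal
      (γ / 2 * Real.sqrt (∑ k ∈ Finset.range K, a k ^ 2))) atTop
      (𝓝 (ENNReal.ofReal (γ / 2 * Real.sqrt (∑' k, a k ^ 2)))) :=
    ENNReal.tendsto_ofReal (((Real.continuous_sqrt.tendsto _).comp
      ha.hasSum.tendsto_sum_nat).const_mul _)
  have hl2 : Tendsto (fun K : ℕ => ENNReal.ofReal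
      (C * Real.sqrt (6 * κ) * Real.sqrt (∑' k, a (k + K) ^ 2))) atTop (𝓝 0) := by
    have := ENNReal.tendsto_ofReal (((Real.continuous_sqrt.tendsto _).comp
      (tendsto_sum_nat_add fun k => a k ^ 2)).const_mul (C * Real.sqrt (6 * κ)))
    simpa using this
  have hl3 := (tendsto_const_nhds (x := X.extNorm (pullRho E hE f))).add hl2
  rw [add_zero] at hl3
  exact le_of_tendsto_of_tendsto' hl1 hl3 hpart
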